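/- Let $M,N$ be the numbers of base-station (BS) antennas and RIS elements, and let $\beta_d,\beta_{br},\beta_{ru},E_s,\sigma>0$, $\bar\tau=E_s/\sigma^2$. Let $R_d\in\mathbb{C}^{M\times M}$ and $R_{ru}\in\mathbb{C}^{N\times N}$ be correlation matrices (Hermitian positive semidefinite with unit diagonal). Let $a_b\in\mathbb{C}^M$, $a_r\in\mathbb{C}^N$ be steering vectors, $\|a_b\|_2^2=M$ and $|a_{r,n}|=1$ for all $n$. Let $u_d\sim\mathcal{CN}(0,I_M)$ and $u_{ru}\sim\mathcal{CN}(0,I_N)$ be independent. With $R^{1/2}$ the positive semidefinite square root, put $$h_d=\sqrt{\beta_d}\,R_d^{1/2}u_d,\qquad \tilde h_{ru}=R_{ru}^{1/2}u_{ru},\qquad h_{ru}=\sqrt{\beta_{ru}}\,\tilde h_{ru},\qquad H_{br}=\sqrt{\beta_{br}}\,a_ba_r^H,$$ $$\psi=\frac{a_b^Hh_d}{|a_b^Hh_d|},\qquad \Phi=\psi\,\mathrm{diag}(e^{j\angle a_r})\,\mathrm{diag}(e^{-j\angle h_{ru}}),\qquad h=h_d+H_{br}\Phi h_{ru},\qquad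 \mathrm{SNR}=h^Hh\,\bar\tau .$$ (This $\Phi$ is the optimal RIS phase matrix and $\mathrm{SNR}$ the optimal uplink SNR.) Let $A=\|R_d^{1/2}a_b\|_2$ and assume $A\neq0$. Let $$B=MA+\frac{a_b^HR_d^2a_b}{2A},\qquad F=\sum_{i\ne j}\frac{\pi}{4}\bigl(1-|\rho_{ij}|^2\bigr)^2\,{}_2F_1\!\left(\tfrac32,\tfrac32;1;|\rho_{ij}|^2\right),\qquad \rho_{ij}=(R_{ru})_{ij},$$ where a summand with $|\rho_{ij}|=1$ is understood as its limit for $|\rho_{ij}|\to1$, which is $1$. Let $Y=\sum_{n=1}^N|\tilde h_{ru,n}|$, $C_1=\mathbb{E}[Y^3]$ and $C_2=\mathbb{E}[Y^4]$. Then $\mathrm{SNR}$ is square integrable, $C_1$ and $C_2$ are finite, and $$\begin{aligned}\mathrm{Var}\{\mathrm{SNR}\}=\Bigl(&\beta_d^2\,\mathrm{tr}(R_d^2)+\beta_d^{3/2}\sqrt{\beta_{br}\beta_{ru}}\,N\pi\,(B-MA)+\beta_d\beta_{br}\beta_{ru}A^2\Bigl(4(N+F)-\frac{N^2\pi^2}{4}\Bigr)\\&+MA\sqrt{\beta_d}\,(\beta_{br}\beta_{ru})^{3/2}\bigl(2\sqrt{\pi}\,C_1-N(N+F)\pi\bigr)+(M\beta_{br}\beta_{ru})^2\bigl(C_2-(N+F)^2\bigr)\Bigr)\bar\tau^2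 .\end{aligned}$$ -/

import Mathlib

open MeasureTheory ProbabilityTheory
open scoped Matrix MatrixOrder ComplexOrder

noncomputable section

namespace RIS

/-- The law `CN(0,1)` on `ℂ`: real and imaginary parts are independent and each is `N(0,1/2)`. -/
def stdComplexGaussian : Measure ℂ :=
  ((gaussianReal 0 (1 / 2)).prod (gaussianReal 0 (1 / 2))).map
    (fun p : ℝ × ℝ => (⟨p.1, p.2⟩ : ℂ))

/-- The law `CN(0, I)` on `ℂⁿ`: the coordinates are i.i.d. with law `CN(0,1)`. -/
def stdComplexGaussianVec (n : ℕ) : Measure (Fin n → ℂ) :=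
  Measure.pi (fun _ => stdComplexGaussian)

/-- A correlation matrix: Hermitian positive semidefinite with unit diagonal. -/
structure IsCorrelationMatrix {n : ℕ} (R : Matrix (Fin n) (Fin n) ℂ) : Prop where
  posSemidef : R.PosSemidef
  diag_eq_one : ∀ i, R i i = 1

/-- The vector `R^{1/2} u`, where `R^{1/2}` is the positive semidefinite square root of `R`. -/
def correlate {n : ℕ} (R : Matrix (Fin n) (Fin n) ℂ) (u : Fin n → ℂ) : Fin n → ℂ :=
  CFC.sqrt R *ᵥ u

/-- A correlated Rayleigh channel `√β R^{1/2} u`. -/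
def rayleigh {n : ℕ} (β : ℝ) (R : Matrix (Fin n) (Fin n) ℂ) (u : Fin n → ℂ) : Fin n → ℂ :=
  ((Real.sqrt β : ℝ) : ℂ) • correlate R u

/-- The rank-one LOS channel `√β a_b a_rᴴ` from the RIS to the BS. -/
def losChannel {M N : ℕ} (β : ℝ) (ab : Fin M → ℂ) (ar : Fin N → ℂ) :
    Matrix (Fin M) (Fin N) ℂ :=
  ((Real.sqrt β : ℝ) : ℂ) • Matrix.vecMulVec ab (star ar)

/-- `ψ = a_bᴴ h_d / |a_bᴴ h_d|`. -/
def psi {M : ℕ} (ab hd : Fin M → ℂ) : ℂ :=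
  (star ab ⬝ᵥ hd) / ((‖star ab ⬝ᵥ hd‖ : ℝ) : ℂ)

/-- The optimal RIS phase matrix `Φ = ψ diag(e^{j∠a_r}) diag(e^{-j∠h_ru})`. -/
def optimalPhase {M N : ℕ} (ab : Fin M → ℂ) (ar : Fin N → ℂ) (hd : Fin M → ℂ)
    (hru : Fin N → ℂ) : Matrix (Fin N) (Fin N) ℂ :=
  psi ab hd •
    (Matrix.diagonal (fun n => Complex.exp (Complex.I * ((ar n).arg : ℂ))) *
      Matrix.diagonal (fun n => Complex.exp (-(Complex.I * ((hru n).arg : ℂ)))))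

/-- The global uplink channel `h = h_d + H_br Φ h_ru`. -/
def globalChannel {M N : ℕ} (hd : Fin M → ℂ) (Hbr : Matrix (Fin M) (Fin N) ℂ)
    (Φ : Matrix (Fin N) (Fin N) ℂ) (hru : Fin N → ℂ) : Fin M → ℂ :=
  hd + (Hbr * Φ) *ᵥ hru

/-- The matched-filter SNR `hᴴ h τ`, where `τ = E_s / σ²`. -/
def snr {M : ℕ} (h : Fin M → ℂ) (τ : ℝ) : ℝ :=
  (star h ⬝ᵥ h).re * τ

/-- The optimal uplink SNR as a function of the underlying vectors `u_d` and `u_ru`. -/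
def optimalSNR {M N : ℕ} (βd βbr βru τ : ℝ)
    (Rd : Matrix (Fin M) (Fin M) ℂ) (Rru : Matrix (Fin N) (Fin N) ℂ)
    (ab : Fin M → ℂ) (ar : Fin N → ℂ) (ud : Fin M → ℂ) (uru : Fin N → ℂ) : ℝ :=
  snr (globalChannel (rayleigh βd Rd ud) (losChannel βbr ab ar)
    (optimalPhase ab ar (rayleigh βd Rd ud) (rayleigh βru Rru uru)) (rayleigh βru Rru uru)) τ

/-- `Y = ∑ₙ |h̃_{ru,n}|` with `h̃_ru = R_ru^{1/2} u_ru`. -/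
def sumAbs {N : ℕ} (Rru : Matrix (Fin N) (Fin N) ℂ) (uru : Fin N → ℂ) : ℝ :=
  ∑ n, ‖correlate Rru uru n‖

/-- `A = ‖R_d^{1/2} a_b‖₂`. -/
def constA {M : ℕ} (Rd : Matrix (Fin M) (Fin M) ℂ) (ab : Fin M → ℂ) : ℝ :=
  Real.sqrt (∑ i, ‖correlate Rd ab i‖ ^ 2)

/-- `B = M A + a_bᴴ R_d² a_b / (2 A)`. -/
def constB {M : ℕ} (Rd : Matrix (Fin M) (Fin M) ℂ) (ab : Fin M → ℂ) : ℝ :=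
  (M : ℝ) * constA Rd ab + (star ab ⬝ᵥ ((Rd ^ 2) *ᵥ ab)).re / (2 * constA Rd ab)

/-- `(π/4) (1 - r²)² ₂F₁(3/2, 3/2; 1; r²)` for `0 ≤ r < 1`. At `r = 1` the hypergeometric series
diverges, and the expression is read as its limit `1` for `r → 1` (by Euler's transformation it
equals `(π/4) ₂F₁(-1/2, -1/2; 1; r²)`, and `₂F₁(-1/2, -1/2; 1; 1) = 4/π`). -/
def hyperTerm (r : ℝ) : ℝ :=
  if r < 1 then
    Real.pi / 4 * (1 - r ^ 2) ^ 2 * ordinaryHypergeometric (3 / 2 : ℝ) (3 / 2) 1 (r ^ 2)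
  else 1

/-- `F`, the sum of the hypergeometric terms over all ordered pairs `i ≠ j`. -/
def constF {N : ℕ} (Rru : Matrix (Fin N) (Fin N) ℂ) : ℝ :=
  ∑ i, ∑ j, if i ≠ j then hyperTerm ‖Rru i j‖ else 0

end RIS

end

namespace RIS

/-! Write `G = ‖R_d^{1/2} u_d‖²`, `T = |a_bᴴ R_d^{1/2} u_d|`, and `Y` as in the statement. The RIS
phases cancel those of `a_r` and `h_ru`, so the reflected path is `√(β_br β_ru) Y ψ a_b`; the factor
`ψ` then puts it in phase with the projection of `h_d` on `a_b`. Hence almost surely SNR/τ̄ is `β_d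
G + 2 √(β_d β_br β_ru) Y T + M β_br β_ru Y²` (`optimalSNR_eq`). Since `(G, T)` is independent of
`Y`, the variance depends only on a few moments (`variance_of_indep_quadratic`).

Apart from `E[Y³]` and `E[Y⁴]`, which stay as `C₁` and `C₂`, each moment is a sum of expectations
involving at most two linear forms of a `CN(0, I)` vector. Two normalized forms with correlation `c`
are jointly distributed as `(z, c z + s w)` with `z`, `w` independent and `|c|² + s² = 1`
(`map_dotProduct_pair`). Terms quadratic in the second form then reduce to radial Gamma integrals.
The remaining one, `E|z||c z + s w|`, gives the hypergeometric terms of `F`: the interaction factor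
of the joint density is expanded in a double power series, rotation invariance kills the
off-diagonal terms, and the diagonal sums to `₂F₁` (`integral_norm_mul_norm_eq_hyperTerm`). -/

instance : IsProbabilityMeasure stdComplexGaussian := by
  unfold stdComplexGaussian
  exact Measure.isProbabilityMeasure_map
    (Complex.measurableEquivRealProd.symm.measurable.aemeasurable)

instance (n : ℕ) : IsProbabilityMeasure (stdComplexGaussianVec n) := by
  unfold stdComplexGaussianVec
  infer_instance

/-! ### Density and radial moments of `CN(0,1)` -/

/-- `CN(0,1)` has density `π⁻¹ e^{-|z|²}`. -/
theorem stdComplexGaussian_eq_withDensity :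
    stdComplexGaussian =
      volume.withDensity (fun z : ℂ => ENNReal.ofReal (Real.pi⁻¹ * Real.exp (-‖z‖ ^ 2))) := by
  have hmp := Complex.volume_preserving_equiv_real_prod.symm
  have hv : (1 / 2 : NNReal) ≠ 0 := by norm_num
  unfold stdComplexGaussian
  rw [gaussianReal_of_var_ne_zero 0 hv,
    prod_withDensity (measurable_gaussianPDF _ _) (measurable_gaussianPDF _ _)]
  change Measure.map Complex.measurableEquivRealProd.symm _ = _
  ext s hs
  rw [Measure.map_apply hmp.measurable hs, withDensity_apply _ (hmp.measurable hs),
    withDensity_apply _ hs, ← hmp.setLIntegral_comp_preimage hs (by fun_prop)]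
  refine setLIntegral_congr_fun (hmp.measurable hs) fun p _ => ?_
  simp only [gaussianPDF, gaussianPDFReal]
  rw [← ENNReal.ofReal_mul (by positivity)]
  congr 1
  have h1 : ‖Complex.measurableEquivRealProd.symm p‖ ^ 2 = p.1 ^ 2 + p.2 ^ 2 := by
    rw [← Complex.normSq_eq_norm_sq, Complex.normSq_apply]
    simp [Complex.measurableEquivRealProd_symm_apply]; ring
  rw [h1]
  have h2 : √(2 * Real.pi * ((1 / 2 : NNReal) : ℝ)) = √Real.pi := by
    congr 1; push_cast; ring
  rw [h2]
  have h3 : Real.exp (-(p.1 ^ 2 + p.2 ^ 2)) = Real.exp (-p.1 ^ 2) * Real.exp (-p.2 ^ 2) := by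
    rw [← Real.exp_add]; ring_nf
  have h4 : Real.pi⁻¹ = (√Real.pi)⁻¹ * (√Real.pi)⁻¹ := by
    rw [← mul_inv, Real.mul_self_sqrt Real.pi_pos.le]
  rw [h3, h4]
  push_cast
  ring_nf

theorem integral_stdComplexGaussian {E : Type*} [NormedAddCommGroup E] [NormedSpace ℝ E]
    (f : ℂ → E) :
    ∫ z, f z ∂stdComplexGaussian = ∫ z, (Real.pi⁻¹ * Real.exp (-‖z‖ ^ 2)) • f z := by
  rw [stdComplexGaussian_eq_withDensity, integral_withDensity_eq_integral_toReal_smul (by fun_prop)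
    (by simp)]
  refine integral_congr_ae (.of_forall fun z => ?_)
  simp only
  rw [ENNReal.toReal_ofReal (by positivity)]

theorem integral_norm_pow_mul_exp (k : ℕ) {b : ℝ} (hb : 0 < b) :
    ∫ z : ℂ, ‖z‖ ^ k * Real.exp (-b * ‖z‖ ^ 2) =
      Real.pi * b ^ (-((k : ℝ) / 2 + 1)) * Real.Gamma ((k : ℝ) / 2 + 1) := by
  have h := Complex.integral_rpow_mul_exp_neg_mul_rpow (p := 2) (q := k) (by norm_num)
    (by linarith [(Nat.cast_nonneg k : (0 : ℝ) ≤ k)]) hb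
  simp only [Real.rpow_natCast, Real.rpow_ofNat] at h
  rw [h]
  ring_nf

theorem integrable_norm_pow_mul_exp (k : ℕ) {b : ℝ} (hb : 0 < b) :
    Integrable fun z : ℂ => ‖z‖ ^ k * Real.exp (-b * ‖z‖ ^ 2) := by
  -- A non-integrable function has Bochner integral 0 by convention, whereas the closed form is
  -- positive.
  by_contra h
  have h1 := integral_norm_pow_mul_exp k hb
  rw [integral_undef h] at h1
  have : 0 < Real.Gamma ((k : ℝ) / 2 + 1) := Real.Gamma_pos_of_pos (by positivity)
  have : 0 < Real.pi * b ^ (-((k : ℝ) / 2 + 1)) * Real.Gamma ((k : ℝ) / 2 + 1) := by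
    have := Real.pi_pos
    positivity
  linarith

theorem integral_norm_pow_stdComplexGaussian (k : ℕ) :
    ∫ z, ‖z‖ ^ k ∂stdComplexGaussian = Real.Gamma ((k : ℝ) / 2 + 1) := by
  rw [integral_stdComplexGaussian]
  have h := integral_norm_pow_mul_exp k one_pos
  rw [Real.one_rpow, mul_one] at h
  rw [← mul_right_inj' Real.pi_ne_zero, ← h, ← integral_const_mul]
  refine integral_congr_ae (.of_forall fun z => ?_)
  have := Real.pi_ne_zero
  simp only [smul_eq_mul]
  field_simp

theorem integrable_norm_pow_stdComplexGaussian (k : ℕ) :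
    Integrable (fun z : ℂ => ‖z‖ ^ k) stdComplexGaussian := by
  by_contra h
  have h1 := integral_norm_pow_stdComplexGaussian k
  rw [integral_undef h] at h1
  have : 0 < Real.Gamma ((k : ℝ) / 2 + 1) := Real.Gamma_pos_of_pos (by positivity)
  linarith

theorem integral_norm_stdComplexGaussian :
    ∫ z, ‖z‖ ∂stdComplexGaussian = √Real.pi / 2 := by
  have h := integral_norm_pow_stdComplexGaussian 1
  simp only [pow_one] at h
  rw [h, Nat.cast_one, Real.Gamma_add_one (by norm_num), Real.Gamma_one_half_eq]
  ring

theorem integral_norm_sq_stdComplexGaussian :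
    ∫ z, ‖z‖ ^ 2 ∂stdComplexGaussian = 1 := by
  rw [integral_norm_pow_stdComplexGaussian 2]
  norm_num

theorem integral_norm_pow_three_stdComplexGaussian :
    ∫ z, ‖z‖ ^ 3 ∂stdComplexGaussian = 3 * √Real.pi / 4 := by
  rw [integral_norm_pow_stdComplexGaussian 3, Real.Gamma_add_one (by norm_num),
    show ((3 : ℕ) : ℝ) / 2 = 1 / 2 + 1 by norm_num, Real.Gamma_add_one (by norm_num),
    Real.Gamma_one_half_eq]
  ring

theorem integral_norm_pow_four_stdComplexGaussian :
    ∫ z, ‖z‖ ^ 4 ∂stdComplexGaussian = 2 := by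
  rw [integral_norm_pow_stdComplexGaussian 4, show ((4 : ℕ) : ℝ) / 2 + 1 = (2 : ℕ) + 1 by norm_num,
    Real.Gamma_nat_eq_factorial]
  norm_num

theorem memLp_id_stdComplexGaussian : MemLp (fun z : ℂ => z) 4 stdComplexGaussian := by
  rw [← integrable_norm_rpow_iff (by fun_prop) (by norm_num) (by norm_num)]
  have := integrable_norm_pow_stdComplexGaussian 4
  simpa using this

theorem ae_ne_zero_stdComplexGaussian : ∀ᵐ z ∂stdComplexGaussian, z ≠ 0 := by
  rw [stdComplexGaussian_eq_withDensity]
  exact (withDensity_absolutelyContinuous _ _).ae_le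
    (compl_mem_ae_iff.2 (measure_singleton (0 : ℂ)))

/-! ### Characteristic functions and joint laws of linear forms -/

/-- The characteristic function of `CN(0,1)`. -/
theorem integral_cexp_stdComplexGaussian (γ : ℂ) :
    ∫ z, Complex.exp (((γ * z).re : ℂ) * Complex.I) ∂stdComplexGaussian =
      Complex.exp ((-(‖γ‖ ^ 2 / 4) : ℝ)) := by
  unfold stdComplexGaussian
  have hme := Complex.measurableEquivRealProd.symm.measurableEmbedding
  have : ∫ z, Complex.exp (((γ * z).re : ℂ) * Complex.I)
      ∂(((gaussianReal 0 (1 / 2)).prod (gaussianReal 0 (1 / 2))).map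
        Complex.measurableEquivRealProd.symm) =
      (∫ x, Complex.exp (γ.re * x * Complex.I) ∂(gaussianReal 0 (1 / 2))) *
      ∫ x, Complex.exp ((-γ.im : ℝ) * x * Complex.I) ∂(gaussianReal 0 (1 / 2)) := by
    rw [hme.integral_map, ← integral_prod_mul]
    refine integral_congr_ae (.of_forall fun p => ?_)
    simp only [Complex.measurableEquivRealProd_symm_apply]
    rw [← Complex.exp_add]
    congr 1
    simp [Complex.mul_re]
    ring
  refine this.trans ?_
  rw [← charFun_apply_real, ← charFun_apply_real, charFun_gaussianReal, charFun_gaussianReal,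
    ← Complex.exp_add, ← Complex.normSq_eq_norm_sq, Complex.normSq_apply]
  congr 1
  push_cast
  ring

theorem integral_cexp_dotProduct {n : ℕ} (a : Fin n → ℂ) :
    ∫ u, Complex.exp (((a ⬝ᵥ u).re : ℂ) * Complex.I) ∂stdComplexGaussianVec n =
      Complex.exp ((-(∑ k, ‖a k‖ ^ 2) / 4 : ℝ)) := by
  unfold stdComplexGaussianVec
  have : ∀ u : Fin n → ℂ, Complex.exp (((a ⬝ᵥ u).re : ℂ) * Complex.I) =
      ∏ k, Complex.exp (((a k * u k).re : ℂ) * Complex.I) := fun u => by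
    rw [← Complex.exp_sum, ← Finset.sum_mul, dotProduct, Complex.re_sum]
    push_cast
    rfl
  simp_rw [this]
  rw [integral_fintype_prod_eq_prod (fun k z => Complex.exp (((a k * z).re : ℂ) * Complex.I))]
  simp_rw [integral_cexp_stdComplexGaussian, ← Complex.exp_sum, ← Complex.ofReal_sum]
  congr 2
  rw [neg_div, Finset.sum_div, ← Finset.sum_neg_distrib]

theorem norm_sq_add_complex (x y : ℂ) :
    ‖x + y‖ ^ 2 = ‖x‖ ^ 2 + ‖y‖ ^ 2 + 2 * (x * star y).re := by
  simp only [← Complex.normSq_eq_norm_sq]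
  exact Complex.normSq_add x y

/-- Every real linear functional on `ℂ` is `z ↦ Re (α z)`. -/
theorem exists_re_mul (L : ℂ →ₗ[ℝ] ℝ) : ∃ α : ℂ, ∀ z, L z = (α * z).re := by
  refine ⟨⟨L 1, -L Complex.I⟩, fun z => ?_⟩
  have : z = z.re • (1 : ℂ) + z.im • Complex.I := by simp
  conv_lhs => rw [this]
  rw [map_add, map_smul, map_smul]
  simp [Complex.mul_re]
  ring

/-- Two linear forms of a `CN(0, I)` vector, the first normalized, are distributed as
`(z, c z + s w)` with `z`, `w` i.i.d. `CN(0,1)`. -/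
theorem map_dotProduct_pair {n : ℕ} (a b : Fin n → ℂ) (c : ℂ) (s : ℝ)
    (ha : ∑ k, ‖a k‖ ^ 2 = 1) (hc : b ⬝ᵥ star a = c)
    (hs : ‖c‖ ^ 2 + s ^ 2 = ∑ k, ‖b k‖ ^ 2) :
    (stdComplexGaussianVec n).map (fun u => (a ⬝ᵥ u, b ⬝ᵥ u)) =
      (stdComplexGaussian.prod stdComplexGaussian).map
        (fun p : ℂ × ℂ => (p.1, c * p.1 + s * p.2)) := by
  have hm1 : Measurable fun u : Fin n → ℂ => (a ⬝ᵥ u, b ⬝ᵥ u) := by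
    unfold dotProduct; fun_prop
  have hm2 : Measurable fun p : ℂ × ℂ => (p.1, c * p.1 + s * p.2) := by fun_prop
  have := Measure.isProbabilityMeasure_map (μ := stdComplexGaussianVec n) hm1.aemeasurable
  have := Measure.isProbabilityMeasure_map (μ := stdComplexGaussian.prod stdComplexGaussian)
    hm2.aemeasurable
  -- A finite measure on `ℂ × ℂ` is determined by its Fourier transform on real functionals, all of
  -- the form `Re (α x + β y)`. Both transforms are Gaussian, so only the two variances need
  -- comparing.
  refine Measure.ext_of_charFunDual ?_
  ext L
  obtain ⟨α, hα⟩ := exists_re_mul (L.toLinearMap ∘ₗ LinearMap.inl ℝ ℂ ℂ)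
  obtain ⟨β, hβ⟩ := exists_re_mul (L.toLinearMap ∘ₗ LinearMap.inr ℝ ℂ ℂ)
  have hL : ∀ x y : ℂ, L (x, y) = (α * x + β * y).re := fun x y => by
    have h1 := hα x
    have h2 := hβ y
    simp only [LinearMap.comp_apply, LinearMap.inl_apply, LinearMap.inr_apply] at h1 h2
    rw [Complex.add_re, ← h1, ← h2]
    change _ = L (x, 0) + L (0, y)
    rw [← map_add]
    simp
  rw [charFunDual_apply, charFunDual_apply, integral_map hm1.aemeasurable (by fun_prop),
    integral_map hm2.aemeasurable (by fun_prop)]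
  simp only [hL]
  have e1 : ∀ u : Fin n → ℂ, α * (a ⬝ᵥ u) + β * (b ⬝ᵥ u) = (α • a + β • b) ⬝ᵥ u := fun u => by
    rw [add_dotProduct, smul_dotProduct, smul_dotProduct, smul_eq_mul, smul_eq_mul]
  simp_rw [e1]
  rw [integral_cexp_dotProduct]
  have e2 : ∀ p : ℂ × ℂ, Complex.exp (((α * p.1 + β * (c * p.1 + s * p.2)).re : ℂ) * Complex.I) =
      Complex.exp ((((α + β * c) * p.1).re : ℂ) * Complex.I) *
        Complex.exp ((((β * s) * p.2).re : ℂ) * Complex.I) := fun p => by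
    rw [← Complex.exp_add, ← add_mul, ← Complex.ofReal_add, ← Complex.add_re]
    ring_nf
  simp_rw [e2]
  rw [integral_prod_mul (fun z : ℂ => Complex.exp ((((α + β * c) * z).re : ℂ) * Complex.I))
    (fun z : ℂ => Complex.exp ((((β * s) * z).re : ℂ) * Complex.I)),
    integral_cexp_stdComplexGaussian, integral_cexp_stdComplexGaussian, ← Complex.exp_add]
  congr 1
  rw [← Complex.ofReal_add]
  congr 1
  have hcross : ∑ k, (α * a k * star (β * b k)).re = (α * star (β * c)).re := by
    rw [← Complex.re_sum, ← hc, dotProduct]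
    congr 1
    rw [star_mul', star_sum, Finset.mul_sum, Finset.mul_sum]
    refine Finset.sum_congr rfl fun k _ => ?_
    simp
    ring
  simp only [Pi.add_apply, Pi.smul_apply, smul_eq_mul]
  simp_rw [norm_sq_add_complex, Finset.sum_add_distrib, ← Finset.mul_sum, hcross, norm_mul,
    mul_pow, ← Finset.mul_sum, ha, ← hs, Complex.norm_real, Real.norm_eq_abs, sq_abs]
  ring

theorem measurable_dotProduct_right {n : ℕ} (a : Fin n → ℂ) :
    Measurable fun u : Fin n → ℂ => a ⬝ᵥ u := by
  unfold dotProduct; fun_prop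

theorem map_dotProduct_eq {n : ℕ} (a : Fin n → ℂ) (ha : ∑ k, ‖a k‖ ^ 2 = 1) :
    (stdComplexGaussianVec n).map (fun u => a ⬝ᵥ u) = stdComplexGaussian := by
  have hc : a ⬝ᵥ star a = 1 := by
    rw [← Complex.ofReal_one, ← ha, dotProduct]
    push_cast
    refine Finset.sum_congr rfl fun k _ => ?_
    simpa using Complex.mul_conj' (a k)
  -- The degenerate pair `b = a` suffices: only its first marginal is used.
  have h := map_dotProduct_pair a a 1 0 ha hc (by simp [ha])
  have h' := congrArg (Measure.map Prod.fst) h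
  rw [Measure.map_map measurable_fst (by unfold dotProduct; fun_prop),
    Measure.map_map measurable_fst (by fun_prop)] at h'
  exact h'.trans (by
    change Measure.map Prod.fst _ = _
    rw [Measure.map_fst_prod]; simp)

theorem memLp_dotProduct {n : ℕ} (a : Fin n → ℂ) :
    MemLp (fun u => a ⬝ᵥ u) 4 (stdComplexGaussianVec n) := by
  unfold dotProduct
  refine memLp_finsetSum _ fun k _ => MemLp.const_mul ?_ _
  exact memLp_id_stdComplexGaussian.comp_measurePreserving
    (measurePreserving_eval (fun _ : Fin n => stdComplexGaussian) k)

theorem integral_id_stdComplexGaussian : ∫ z, z ∂stdComplexGaussian = 0 := by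
  rw [integral_stdComplexGaussian]
  have h := integral_neg_eq_self (fun z : ℂ => (Real.pi⁻¹ * Real.exp (-‖z‖ ^ 2)) • z) volume
  simp only [norm_neg, smul_neg] at h
  rw [integral_neg] at h
  exact self_eq_neg.1 h.symm

/-- Second moment of `c z + s w` weighted by a function of `z`. -/
theorem integral_mul_norm_sq_add (f : ℂ → ℝ) (c : ℂ) (s : ℝ)
    (hf : Integrable f stdComplexGaussian)
    (hf1 : Integrable (fun z => (f z : ℂ) * z) stdComplexGaussian)
    (hf2 : Integrable (fun z => f z * ‖z‖ ^ 2) stdComplexGaussian) :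
    ∫ p, f p.1 * ‖c * p.1 + s * p.2‖ ^ 2 ∂(stdComplexGaussian.prod stdComplexGaussian) =
      ‖c‖ ^ 2 * ∫ z, f z * ‖z‖ ^ 2 ∂stdComplexGaussian + s ^ 2 * ∫ z, f z ∂stdComplexGaussian := by
  have hid : Integrable (fun z : ℂ => star z) stdComplexGaussian := by
    have := memLp_id_stdComplexGaussian.integrable (by norm_num)
    exact (LinearIsometryEquiv.integrable_comp_iff Complex.conjLIE).2 this
  have hsq := integrable_norm_pow_stdComplexGaussian 2
  have i1 : Integrable (fun p : ℂ × ℂ => f p.1 * ‖p.1‖ ^ 2)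
      (stdComplexGaussian.prod stdComplexGaussian) := hf2.comp_fst _
  have i2 : Integrable (fun p : ℂ × ℂ => f p.1 * ‖p.2‖ ^ 2)
      (stdComplexGaussian.prod stdComplexGaussian) := hf.mul_prod hsq
  have i3 : Integrable (fun p : ℂ × ℂ => (f p.1 * p.1) * star p.2)
      (stdComplexGaussian.prod stdComplexGaussian) := hf1.mul_prod hid
  have i3' : Integrable (fun p : ℂ × ℂ => (2 * (c * s) * ((f p.1 * p.1) * star p.2)).re)
      (stdComplexGaussian.prod stdComplexGaussian) := (i3.const_mul (2 * (c * s))).re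
  have i12 : Integrable (fun p : ℂ × ℂ => ‖c‖ ^ 2 * (f p.1 * ‖p.1‖ ^ 2) +
      s ^ 2 * (f p.1 * ‖p.2‖ ^ 2)) (stdComplexGaussian.prod stdComplexGaussian) :=
    (i1.const_mul _).add (i2.const_mul _)
  have hpt : ∀ p : ℂ × ℂ, f p.1 * ‖c * p.1 + s * p.2‖ ^ 2 =
      ‖c‖ ^ 2 * (f p.1 * ‖p.1‖ ^ 2) + s ^ 2 * (f p.1 * ‖p.2‖ ^ 2) +
        (2 * (c * s) * ((f p.1 * p.1) * star p.2)).re := fun p => by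
    have : (2 * (c * s) * ((f p.1 * p.1) * star p.2)).re =
        f p.1 * (2 * ((c * p.1) * star (s * p.2)).re) := by
      rw [← Complex.re_ofReal_mul 2, ← Complex.re_ofReal_mul (f p.1)]
      congr 1
      simp
      ring
    rw [this, norm_sq_add_complex, norm_mul, norm_mul, Complex.norm_real, Real.norm_eq_abs]
    rw [mul_pow, mul_pow, sq_abs]
    ring
  simp_rw [hpt]
  -- The cross term vanishes because `w` is centred and independent of `z`.
  have hz : ∫ p : ℂ × ℂ, (2 * (c * s) * ((f p.1 * p.1) * star p.2)).re
      ∂(stdComplexGaussian.prod stdComplexGaussian) = 0 := by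
    have e := integral_re (𝕜 := ℂ) (i3.const_mul (2 * (c * s)))
    refine e.trans ?_
    rw [integral_const_mul, integral_prod_mul (fun z : ℂ => (f z : ℂ) * z) (fun z : ℂ => star z)]
    have : ∫ z : ℂ, star z ∂stdComplexGaussian = 0 := by
      have := integral_conj (μ := stdComplexGaussian) (f := fun z : ℂ => z) (𝕜 := ℂ)
      rw [integral_id_stdComplexGaussian, map_zero] at this
      exact this
    rw [this]
    simp
  rw [integral_add i12 i3', hz,
    integral_add (i1.const_mul _) (i2.const_mul _), integral_const_mul, integral_const_mul,
    integral_prod_mul f (fun z : ℂ => ‖z‖ ^ 2), integral_norm_sq_stdComplexGaussian,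
    integral_fun_fst (fun z : ℂ => f z * ‖z‖ ^ 2)]
  simp

/-! ### Mean product of two correlated moduli as a hypergeometric series -/

theorem Gamma_add_three_halves (k : ℕ) :
    Real.Gamma (k + 3 / 2) = √Real.pi / 2 * (ascPochhammer ℝ k).eval (3 / 2) := by
  induction k with
  | zero =>
    rw [show ((0 : ℕ) : ℝ) + 3 / 2 = 1 / 2 + 1 by norm_num, Real.Gamma_add_one (by norm_num),
      Real.Gamma_one_half_eq]
    simp
    ring
  | succ k ih =>
    rw [show ((k + 1 : ℕ) : ℝ) + 3 / 2 = (k + 3 / 2) + 1 by push_cast; ring,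
      Real.Gamma_add_one (by positivity), ih, ascPochhammer_succ_eval]
    ring

/-- The constant `π/4` is the square of the factor `√π/2` in `Γ(k + 3/2) = (√π/2) (3/2)_k`. The
comparison is term by term, so no condition on `x` is needed. -/
theorem ordinaryHypergeometric_three_halves (x : ℝ) :
    Real.pi / 4 * ordinaryHypergeometric (3 / 2 : ℝ) (3 / 2) 1 x =
      ∑' k : ℕ, (Real.Gamma (k + 3 / 2) / k.factorial) ^ 2 * x ^ k := by
  rw [ordinaryHypergeometric_eq_tsum, ← tsum_mul_left]
  refine tsum_congr fun k => ?_
  rw [Gamma_add_three_halves, ascPochhammer_eval_one, smul_eq_mul]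
  have h : √Real.pi ^ 2 = Real.pi := Real.sq_sqrt Real.pi_pos.le
  field_simp
  rw [h]
  ring

/-- Radially weighted off-diagonal monomials integrate to zero. -/
theorem integral_radial_mul_monomial_eq_zero (f : ℝ → ℝ) {j k : ℕ} (hjk : j ≠ k) :
    ∫ z : ℂ, (f ‖z‖ : ℂ) * (z ^ j * star z ^ k) = 0 := by
  -- Rotation by this angle multiplies `z^j z̄^k` by `e^{i(j-k)θ} = -1`, so the integral equals its
  -- own negative.
  set θ : ℝ := Real.pi / ((j : ℝ) - k)
  have hd : (j : ℝ) - k ≠ 0 := sub_ne_zero.2 (by exact_mod_cast hjk)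
  have h := (rotation (Circle.exp θ)).measurePreserving.integral_comp
    (rotation (Circle.exp θ)).toHomeomorph.measurableEmbedding
    (fun z : ℂ => (f ‖z‖ : ℂ) * (z ^ j * star z ^ k))
  have e : ∀ z : ℂ, (f ‖rotation (Circle.exp θ) z‖ : ℂ) *
      (rotation (Circle.exp θ) z ^ j * star (rotation (Circle.exp θ) z) ^ k) =
      -((f ‖z‖ : ℂ) * (z ^ j * star z ^ k)) := fun z => by
    rw [LinearIsometryEquiv.norm_map, rotation_apply, star_mul']
    have h1 : (Circle.exp θ : ℂ) ^ j * star (Circle.exp θ : ℂ) ^ k = -1 := by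
      rw [Circle.coe_exp]
      change _ * ((starRingEnd ℂ) _) ^ k = _
      rw [← Complex.exp_conj, ← Complex.exp_nat_mul, ← Complex.exp_nat_mul, ← Complex.exp_add,
        ← Complex.exp_pi_mul_I]
      congr 1
      have : (Real.pi : ℂ) = ((j : ℂ) - k) * θ := by
        have : Real.pi = ((j : ℝ) - k) * θ := by simp only [θ]; field_simp
        exact_mod_cast congrArg Complex.ofReal this
      rw [this]
      simp
      ring
    rw [mul_pow, mul_pow]
    linear_combination (f ‖z‖ : ℂ) * (z ^ j * star z ^ k) * h1
  simp_rw [e] at h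
  rw [integral_neg] at h
  exact self_eq_neg.1 h.symm

theorem integral_radial_mul_monomial_self {b : ℝ} (hb : 0 < b) (k : ℕ) :
    ∫ z : ℂ, ((‖z‖ * Real.exp (-b * ‖z‖ ^ 2) : ℝ) : ℂ) * (z ^ k * star z ^ k) =
      ((Real.pi * b ^ (-((k : ℝ) + 3 / 2)) * Real.Gamma (k + 3 / 2) : ℝ) : ℂ) := by
  have h := integral_norm_pow_mul_exp (2 * k + 1) hb
  have e : ((2 * k + 1 : ℕ) : ℝ) / 2 + 1 = k + 3 / 2 := by push_cast; ring
  rw [e] at h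
  rw [← h, ← integral_complex_ofReal]
  refine integral_congr_ae (.of_forall fun z => ?_)
  simp only
  rw [← mul_pow]
  have : z * star z = ((‖z‖ ^ 2 : ℝ) : ℂ) := by
    simpa using Complex.mul_conj' z
  rw [this]
  push_cast
  ring

/-- The joint density kernel of two correlated complex Gaussians, weighted by both moduli. -/
noncomputable def modulusKernel (b : ℝ) (κ : ℂ) (p : ℂ × ℂ) : ℝ :=
  ‖p.1‖ * Real.exp (-b * ‖p.1‖ ^ 2) * (‖p.2‖ * Real.exp (-b * ‖p.2‖ ^ 2)) *
    Real.exp (2 * (κ * p.1 * star p.2).re)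

/-- Since `2|z||w| ≤ |z|² + |w|²`, the two growing exponentials cost at most `‖κ‖` of the decay rate
`b` in each variable. This function dominates both the kernel and its series expansion. -/
theorem integrable_modulusKernel_bound {b : ℝ} {κ : ℂ} (hκ : ‖κ‖ < b) :
    Integrable fun p : ℂ × ℂ => ‖p.1‖ * Real.exp (-b * ‖p.1‖ ^ 2) *
      (‖p.2‖ * Real.exp (-b * ‖p.2‖ ^ 2)) *
        (Real.exp (‖κ * p.1 * star p.2‖) * Real.exp (‖κ * p.1 * star p.2‖)) := by
  have hb : 0 < b - ‖κ‖ := by linarith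
  have h1 := integrable_norm_pow_mul_exp 1 hb
  have h2 := h1.mul_prod h1
  refine h2.mono' (by fun_prop) (.of_forall fun p => ?_)
  rw [Real.norm_eq_abs, abs_of_nonneg (by positivity), norm_mul, norm_mul, norm_star]
  have : Real.exp (-b * ‖p.1‖ ^ 2) * Real.exp (-b * ‖p.2‖ ^ 2) *
      (Real.exp (‖κ‖ * ‖p.1‖ * ‖p.2‖) * Real.exp (‖κ‖ * ‖p.1‖ * ‖p.2‖)) ≤
      Real.exp (-(b - ‖κ‖) * ‖p.1‖ ^ 2) * Real.exp (-(b - ‖κ‖) * ‖p.2‖ ^ 2) := by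
    simp only [← Real.exp_add]
    refine Real.exp_le_exp.2 ?_
    nlinarith [mul_nonneg (norm_nonneg κ) (sq_nonneg (‖p.1‖ - ‖p.2‖))]
  calc _ = ‖p.1‖ * ‖p.2‖ * (Real.exp (-b * ‖p.1‖ ^ 2) * Real.exp (-b * ‖p.2‖ ^ 2) *
      (Real.exp (‖κ‖ * ‖p.1‖ * ‖p.2‖) * Real.exp (‖κ‖ * ‖p.1‖ * ‖p.2‖))) := by ring
    _ ≤ ‖p.1‖ * ‖p.2‖ * _ := mul_le_mul_of_nonneg_left this (by positivity)
    _ = _ := by ring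

theorem integrable_modulusKernel {b : ℝ} {κ : ℂ} (hκ : ‖κ‖ < b) :
    Integrable (modulusKernel b κ) := by
  refine (integrable_modulusKernel_bound hκ).mono' ?_ (.of_forall fun p => ?_)
  · unfold modulusKernel; fun_prop
  · unfold modulusKernel
    rw [Real.norm_eq_abs, abs_of_nonneg (by positivity), ← Real.exp_add]
    refine mul_le_mul_of_nonneg_left (Real.exp_le_exp.2 ?_) (by positivity)
    linarith [Complex.re_le_norm (κ * p.1 * star p.2)]

theorem hasSum_prod_mul {R : Type*} [NormedField R] [CompleteSpace R] {f g : ℕ → R} {a b : R}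
    (hf : HasSum f a) (hg : HasSum g b) (hfn : Summable fun j => ‖f j‖)
    (hgn : Summable fun j => ‖g j‖) : HasSum (fun i : ℕ × ℕ => f i.1 * g i.2) (a * b) :=
  hf.mul hg (summable_mul_of_summable_norm hfn hgn)

theorem hasSum_pow_div_factorial_mul (x : ℝ) :
    HasSum (fun i : ℕ × ℕ => (x ^ i.1 / i.1.factorial) * (x ^ i.2 / i.2.factorial))
      (Real.exp x * Real.exp x) := by
  have h : HasSum (fun j : ℕ => x ^ j / j.factorial) (Real.exp x) := by
    rw [Real.exp_eq_exp_ℝ]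
    exact NormedSpace.expSeries_div_hasSum_exp x
  have hn : Summable (fun j : ℕ => ‖x ^ j / j.factorial‖) :=
    (Real.summable_pow_div_factorial x).norm
  exact hasSum_prod_mul (f := fun j : ℕ => x ^ j / j.factorial)
    (g := fun j : ℕ => x ^ j / j.factorial) h h hn hn

/-- Splitting `e^{2 Re x}` as `e^x e^{x̄}` separates powers of `x` from powers of `x̄`, so that
angular orthogonality can be applied to each term. -/
theorem hasSum_pow_mul_star_pow_div_factorial (x : ℂ) :
    HasSum (fun i : ℕ × ℕ => (x ^ i.1 / i.1.factorial) * (star x ^ i.2 / i.2.factorial))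
      ((Real.exp (2 * x.re) : ℝ) : ℂ) := by
  have h : ∀ x : ℂ, HasSum (fun j : ℕ => x ^ j / j.factorial) (Complex.exp x) := fun x => by
    rw [Complex.exp_eq_exp_ℂ]
    exact NormedSpace.expSeries_div_hasSum_exp x
  have hn : ∀ x : ℂ, Summable (fun j : ℕ => ‖x ^ j / j.factorial‖) := fun x => by
    simp only [norm_div, norm_pow, Complex.norm_natCast]
    exact Real.summable_pow_div_factorial ‖x‖
  have e : ((Real.exp (2 * x.re) : ℝ) : ℂ) = Complex.exp x * Complex.exp (star x) := by
    rw [← Complex.exp_add, Complex.ofReal_exp]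
    congr 1
    simpa using (Complex.add_conj x).symm
  rw [e]
  exact hasSum_prod_mul (f := fun j : ℕ => x ^ j / j.factorial)
    (g := fun j : ℕ => star x ^ j / j.factorial) (h x) (h (star x)) (hn x) (hn (star x))

/-- The terms of the double power series expansion of `modulusKernel`. -/
noncomputable def modulusKernelTerm (b : ℝ) (κ : ℂ) (i : ℕ × ℕ) (p : ℂ × ℂ) : ℂ :=
  ((‖p.1‖ * Real.exp (-b * ‖p.1‖ ^ 2) * (‖p.2‖ * Real.exp (-b * ‖p.2‖ ^ 2)) : ℝ) : ℂ) *
    (((κ * p.1 * star p.2) ^ i.1 / i.1.factorial) *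
      (star (κ * p.1 * star p.2) ^ i.2 / i.2.factorial))

theorem hasSum_integral_modulusKernelTerm {b : ℝ} {κ : ℂ} (hκ : ‖κ‖ < b) :
    HasSum (fun i : ℕ × ℕ => ∫ p, modulusKernelTerm b κ i p)
      (∫ p, ((modulusKernel b κ p : ℝ) : ℂ)) := by
  have hbd : ∀ p : ℂ × ℂ, HasSum (fun i : ℕ × ℕ => ‖p.1‖ * Real.exp (-b * ‖p.1‖ ^ 2) *
      (‖p.2‖ * Real.exp (-b * ‖p.2‖ ^ 2)) *
      ((‖κ * p.1 * star p.2‖ ^ i.1 / i.1.factorial) *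
      (‖κ * p.1 * star p.2‖ ^ i.2 / i.2.factorial))) _ := fun p =>
    (hasSum_pow_div_factorial_mul ‖κ * p.1 * star p.2‖).mul_left _
  refine hasSum_integral_of_dominated_convergence
    (fun i p => ‖p.1‖ * Real.exp (-b * ‖p.1‖ ^ 2) * (‖p.2‖ * Real.exp (-b * ‖p.2‖ ^ 2)) *
      ((‖κ * p.1 * star p.2‖ ^ i.1 / i.1.factorial) *
      (‖κ * p.1 * star p.2‖ ^ i.2 / i.2.factorial))) (fun i => ?_)
    (fun i => .of_forall fun p => ?_) (.of_forall fun p => (hbd p).summable) ?_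
    (.of_forall fun p => ?_)
  · unfold modulusKernelTerm
    fun_prop
  · unfold modulusKernelTerm
    rw [norm_mul, Complex.norm_real, Real.norm_eq_abs, abs_of_nonneg (by positivity), norm_mul,
      norm_div, norm_div, norm_pow, norm_pow, norm_star, Complex.norm_natCast,
      Complex.norm_natCast]
  · simp_rw [fun p => (hbd p).tsum_eq]
    exact integrable_modulusKernel_bound hκ
  · unfold modulusKernelTerm modulusKernel
    rw [Complex.ofReal_mul (_ * _) (Real.exp (2 * _))]
    exact (hasSum_pow_mul_star_pow_div_factorial _).mul_left _

theorem integral_modulusKernelTerm (b : ℝ) (κ : ℂ) (i : ℕ × ℕ) :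
    ∫ p, modulusKernelTerm b κ i p =
      κ ^ i.1 * star κ ^ i.2 / (i.1.factorial * i.2.factorial) *
      ((∫ z : ℂ, ((‖z‖ * Real.exp (-b * ‖z‖ ^ 2) : ℝ) : ℂ) * (z ^ i.1 * star z ^ i.2)) *
        ∫ z : ℂ, ((‖z‖ * Real.exp (-b * ‖z‖ ^ 2) : ℝ) : ℂ) * (z ^ i.2 * star z ^ i.1)) := by
  rw [← integral_prod_mul, ← integral_const_mul]
  refine integral_congr_ae (.of_forall fun p => ?_)
  simp only [modulusKernelTerm, star_mul', star_star, mul_pow, Complex.ofReal_mul]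
  ring

theorem hasSum_integral_modulusKernel {b : ℝ} {κ : ℂ} (hκ : ‖κ‖ < b) :
    HasSum (fun k : ℕ => (‖κ‖ ^ k / k.factorial *
      (Real.pi * b ^ (-((k : ℝ) + 3 / 2)) * Real.Gamma (k + 3 / 2))) ^ 2)
      (∫ p, modulusKernel b κ p) := by
  have hb : 0 < b := (norm_nonneg κ).trans_lt hκ
  have hinj : Function.Injective (fun k : ℕ => (k, k)) := fun a b h => (Prod.mk.inj h).1
  -- Terms with unequal exponents integrate to zero, so the double series collapses to its diagonal.
  have hdiag := (hinj.hasSum_iff (fun i hi => by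
    rw [integral_modulusKernelTerm, integral_radial_mul_monomial_eq_zero
      (fun r => r * Real.exp (-b * r ^ 2)) (j := i.1) (k := i.2)
      (fun h => hi ⟨i.1, Prod.ext rfl h⟩)]
    simp)).2 (hasSum_integral_modulusKernelTerm hκ)
  rw [integral_complex_ofReal] at hdiag
  rw [← Complex.hasSum_ofReal]
  refine hdiag.congr_fun fun k => ?_
  simp only [Function.comp_apply]
  rw [integral_modulusKernelTerm, integral_radial_mul_monomial_self hb, ← mul_pow]
  have : κ * star κ = ((‖κ‖ ^ 2 : ℝ) : ℂ) := by
    simpa using Complex.mul_conj' κ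
  rw [this]
  push_cast
  field_simp
  ring

theorem memLp_add_mul_stdComplexGaussian (c : ℂ) (s : ℝ) :
    MemLp (fun p : ℂ × ℂ => c * p.1 + s * p.2) 4
      (stdComplexGaussian.prod stdComplexGaussian) :=
  ((memLp_id_stdComplexGaussian.comp_fst _).const_mul _).add
    ((memLp_id_stdComplexGaussian.comp_snd _).const_mul _)

theorem integrable_norm_mul_norm {α : Type*} [MeasurableSpace α] {μ : Measure α}
    [IsProbabilityMeasure μ] {f g : α → ℂ} (hf : MemLp f 4 μ) (hg : MemLp g 4 μ) :
    Integrable (fun x => ‖f x‖ * ‖g x‖) μ :=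
  (hf.mono_exponent (by norm_num : (2 : ENNReal) ≤ 4)).norm.integrable_mul
    (hg.mono_exponent (by norm_num : (2 : ENNReal) ≤ 4)).norm

/-- Affine substitution in a plane Gaussian integral. -/
theorem integral_gaussian_add_mul (m : ℂ) {s : ℝ} (hs : 0 < s) (f : ℂ → ℝ) :
    ∫ w : ℂ, Real.exp (-‖w‖ ^ 2) * f (m + s * w) =
      (s ^ 2)⁻¹ * ∫ y : ℂ, Real.exp (-‖y - m‖ ^ 2 / s ^ 2) * f y := by
  have h1 := Measure.integral_comp_smul (volume : Measure ℂ)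
    (fun x : ℂ => Real.exp (-‖x‖ ^ 2 / s ^ 2) * f (m + x)) s
  rw [Complex.finrank_real_complex, abs_of_nonneg (by positivity), smul_eq_mul] at h1
  have h2 := integral_sub_right_eq_self
    (fun x : ℂ => Real.exp (-‖x‖ ^ 2 / s ^ 2) * f (m + x)) (μ := volume) m
  rw [← h2] at h1
  convert h1 using 3 with w
  · rw [norm_smul, Real.norm_eq_abs, mul_pow, sq_abs, Complex.real_smul]
    congr 2
    field_simp
  · simp only [add_sub_cancel]

/-- For fixed `z`, substitute `y = c z + s w` and expand the Gaussian exponent. As `|c|² = 1 - s²`,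
both squared moduli receive the coefficient `-1/s²` and the cross term has `κ = c/s²`; `‖κ‖ < b`
then amounts to `|c| < 1`. -/
theorem integral_norm_mul_norm_add (c : ℂ) {s : ℝ} (hs : 0 < s) (hcs : ‖c‖ ^ 2 + s ^ 2 = 1) :
    ∫ p, ‖p.1‖ * ‖c * p.1 + s * p.2‖ ∂(stdComplexGaussian.prod stdComplexGaussian) =
      (Real.pi ^ 2 * s ^ 2)⁻¹ * ∫ p, modulusKernel (s ^ 2)⁻¹ (c / s ^ 2) p := by
  have hc1 : ‖c‖ < 1 := by nlinarith [norm_nonneg c, pow_pos hs 2]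
  have hκ : ‖c / (s : ℂ) ^ 2‖ < (s ^ 2)⁻¹ := by
    rw [norm_div, norm_pow, Complex.norm_real, Real.norm_eq_abs, sq_abs, div_eq_mul_inv]
    exact mul_lt_of_lt_one_left (by positivity) hc1
  have hint := integrable_norm_mul_norm (memLp_id_stdComplexGaussian.comp_fst stdComplexGaussian)
    (memLp_add_mul_stdComplexGaussian c s)
  rw [integral_prod _ hint, Measure.volume_eq_prod, integral_prod _ (integrable_modulusKernel hκ),
    integral_stdComplexGaussian, ← integral_const_mul]
  refine integral_congr_ae (.of_forall fun z => ?_)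
  simp only [smul_eq_mul]
  rw [integral_const_mul, integral_stdComplexGaussian]
  simp only [smul_eq_mul, mul_assoc]
  rw [integral_const_mul, integral_gaussian_add_mul (c * z) hs (fun y => ‖y‖)]
  have hpi := Real.pi_ne_zero
  have hker : ∀ y, modulusKernel (s ^ 2)⁻¹ (c / s ^ 2) (z, y) =
      (Real.exp (-‖z‖ ^ 2) * ‖z‖) * (Real.exp (-‖y - c * z‖ ^ 2 / s ^ 2) * ‖y‖) := fun y => by
    unfold modulusKernel
    have e1 : Real.exp (-(s ^ 2)⁻¹ * ‖z‖ ^ 2) * Real.exp (-(s ^ 2)⁻¹ * ‖y‖ ^ 2) *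
        Real.exp (2 * (c / (s : ℂ) ^ 2 * z * star y).re) =
        Real.exp (-‖z‖ ^ 2) * Real.exp (-‖y - c * z‖ ^ 2 / s ^ 2) := by
      simp only [← Real.exp_add]
      congr 1
      have e2 : (c / (s : ℂ) ^ 2 * z * star y).re = (s ^ 2)⁻¹ * (c * z * star y).re := by
        rw [← Complex.re_ofReal_mul]
        congr 1
        push_cast
        ring
      have e3 : ‖y - c * z‖ ^ 2 = ‖c‖ ^ 2 * ‖z‖ ^ 2 + ‖y‖ ^ 2 - 2 * (c * z * star y).re := by
        rw [norm_sub_rev, sub_eq_add_neg, norm_sq_add_complex, norm_neg, norm_mul, star_neg,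
          mul_neg, Complex.neg_re]
        ring
      rw [e2, e3, show ‖c‖ ^ 2 = 1 - s ^ 2 by linarith]
      field_simp
      ring
    linear_combination ‖z‖ * ‖y‖ * e1
  simp_rw [hker]
  rw [integral_const_mul]
  field_simp

/-- The mean product of the moduli of two unit complex Gaussians with correlation `c`. -/
theorem integral_norm_mul_norm_eq_hyperTerm (c : ℂ) {s : ℝ} (hs : 0 ≤ s)
    (hcs : ‖c‖ ^ 2 + s ^ 2 = 1) :
    ∫ p, ‖p.1‖ * ‖c * p.1 + s * p.2‖ ∂(stdComplexGaussian.prod stdComplexGaussian) =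
      hyperTerm ‖c‖ := by
  rcases hs.eq_or_lt with rfl | hs
  -- Full correlation: the two moduli coincide, and `E|z|² = 1` is the limiting value chosen in
  -- `hyperTerm`.
  · have hc : ‖c‖ = 1 := by
      have : ‖c‖ ^ 2 = 1 := by linarith
      exact (pow_eq_one_iff_of_nonneg (norm_nonneg c) two_ne_zero).1 this
    have e : ∀ p : ℂ × ℂ, ‖p.1‖ * ‖c * p.1 + ((0 : ℝ) : ℂ) * p.2‖ = ‖p.1‖ ^ 2 := fun p => by
      simp [hc, sq]
    simp_rw [e]
    rw [integral_fun_fst (fun z : ℂ => ‖z‖ ^ 2), integral_norm_sq_stdComplexGaussian, hyperTerm,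
      if_neg (by simp [hc])]
    simp
  · have hc1 : ‖c‖ < 1 := by nlinarith [norm_nonneg c, pow_pos hs 2]
    have hκn : ‖c / (s : ℂ) ^ 2‖ = ‖c‖ / s ^ 2 := by
      rw [norm_div, norm_pow, Complex.norm_real, Real.norm_eq_abs, sq_abs]
    have hκ : ‖c / (s : ℂ) ^ 2‖ < (s ^ 2)⁻¹ := by
      rw [hκn, div_eq_mul_inv]
      exact mul_lt_of_lt_one_left (by positivity) hc1
    rw [integral_norm_mul_norm_add c hs hcs, ← (hasSum_integral_modulusKernel hκ).tsum_eq,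
      hyperTerm, if_pos hc1, show 1 - ‖c‖ ^ 2 = s ^ 2 by linarith, mul_right_comm,
      ordinaryHypergeometric_three_halves, ← tsum_mul_left, ← tsum_mul_right]
    refine tsum_congr fun k => ?_
    -- Squared, this power gives `s^{4k+6}`; `‖κ‖^{2k}` removes `s^{4k}` and the prefactor removes
    -- `s²`. What remains is `s⁴ = (1 - |c|²)²`, the prefactor in `hyperTerm`.
    have hpow : ((s ^ 2)⁻¹ : ℝ) ^ (-((k : ℝ) + 3 / 2)) = s ^ (2 * k + 3) := by
      rw [Real.rpow_neg (by positivity), Real.inv_rpow (by positivity), inv_inv,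
        ← Real.rpow_natCast s 2, ← Real.rpow_mul hs.le, ← Real.rpow_natCast s (2 * k + 3)]
      congr 1
      push_cast
      ring
    have hpi := Real.pi_ne_zero
    rw [hpow, hκn, div_pow]
    field_simp
    ring

/-! ### Mixed moments of two normalized linear forms -/

section linearForms

variable {n : ℕ} {a b : Fin n → ℂ}

theorem norm_dotProduct_star_le_one (ha : ∑ k, ‖a k‖ ^ 2 = 1) (hb : ∑ k, ‖b k‖ ^ 2 = 1) :
    ‖b ⬝ᵥ star a‖ ≤ 1 := by
  calc ‖b ⬝ᵥ star a‖ ≤ ∑ k, ‖b k * star (a k)‖ := norm_sum_le _ _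
    _ ≤ ∑ k, (‖a k‖ ^ 2 + ‖b k‖ ^ 2) / 2 := Finset.sum_le_sum fun k _ => by
      rw [norm_mul, norm_star]
      nlinarith [sq_nonneg (‖a k‖ - ‖b k‖)]
    _ = 1 := by rw [← Finset.sum_div, Finset.sum_add_distrib, ha, hb]; norm_num

theorem integral_dotProduct_pair (ha : ∑ k, ‖a k‖ ^ 2 = 1) (hb : ∑ k, ‖b k‖ ^ 2 = 1) :
    ∃ s : ℝ, 0 ≤ s ∧ ‖b ⬝ᵥ star a‖ ^ 2 + s ^ 2 = 1 ∧
      ∀ f : ℂ × ℂ → ℝ, Continuous f →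
        ∫ u, f (a ⬝ᵥ u, b ⬝ᵥ u) ∂stdComplexGaussianVec n =
          ∫ p, f (p.1, b ⬝ᵥ star a * p.1 + s * p.2)
            ∂(stdComplexGaussian.prod stdComplexGaussian) := by
  have h1 := norm_dotProduct_star_le_one ha hb
  have h2 : 0 ≤ 1 - ‖b ⬝ᵥ star a‖ ^ 2 := by nlinarith [norm_nonneg (b ⬝ᵥ star a)]
  have h3 : ‖b ⬝ᵥ star a‖ ^ 2 + √(1 - ‖b ⬝ᵥ star a‖ ^ 2) ^ 2 = 1 := by
    rw [Real.sq_sqrt h2]; ring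
  refine ⟨√(1 - ‖b ⬝ᵥ star a‖ ^ 2), Real.sqrt_nonneg _, h3, fun f hf => ?_⟩
  have h := map_dotProduct_pair a b _ _ ha rfl (h3.trans hb.symm)
  rw [← integral_map (f := f) (φ := fun u => (a ⬝ᵥ u, b ⬝ᵥ u))
    ((measurable_dotProduct_right a).prodMk (measurable_dotProduct_right b)).aemeasurable
    hf.aestronglyMeasurable, h, integral_map (by fun_prop) hf.aestronglyMeasurable]

theorem integral_norm_mul_norm_dotProduct (ha : ∑ k, ‖a k‖ ^ 2 = 1)
    (hb : ∑ k, ‖b k‖ ^ 2 = 1) :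
    ∫ u, ‖a ⬝ᵥ u‖ * ‖b ⬝ᵥ u‖ ∂stdComplexGaussianVec n = hyperTerm ‖b ⬝ᵥ star a‖ := by
  obtain ⟨s, hs, hcs, h⟩ := integral_dotProduct_pair ha hb
  rw [h (fun p => ‖p.1‖ * ‖p.2‖) (by fun_prop), integral_norm_mul_norm_eq_hyperTerm _ hs hcs]

theorem integral_norm_sq_mul_norm_sq_dotProduct (ha : ∑ k, ‖a k‖ ^ 2 = 1)
    (hb : ∑ k, ‖b k‖ ^ 2 = 1) :
    ∫ u, ‖a ⬝ᵥ u‖ ^ 2 * ‖b ⬝ᵥ u‖ ^ 2 ∂stdComplexGaussianVec n = 1 + ‖b ⬝ᵥ star a‖ ^ 2 := by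
  obtain ⟨s, hs, hcs, h⟩ := integral_dotProduct_pair ha hb
  rw [h (fun p => ‖p.1‖ ^ 2 * ‖p.2‖ ^ 2) (by fun_prop)]
  have i4 : Integrable (fun z : ℂ => ‖z‖ ^ 2 * ‖z‖ ^ 2) stdComplexGaussian := by
    simp_rw [← pow_add]
    exact integrable_norm_pow_stdComplexGaussian 4
  rw [integral_mul_norm_sq_add (fun z => ‖z‖ ^ 2) _ _ (integrable_norm_pow_stdComplexGaussian 2)
    ?_ i4, integral_norm_sq_stdComplexGaussian]
  · simp_rw [← pow_add]
    rw [integral_norm_pow_four_stdComplexGaussian]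
    linarith
  · refine (integrable_norm_pow_stdComplexGaussian 3).mono' (by fun_prop)
      (.of_forall fun z => ?_)
    simp [pow_succ]

theorem integral_norm_mul_norm_sq_dotProduct (ha : ∑ k, ‖a k‖ ^ 2 = 1)
    (hb : ∑ k, ‖b k‖ ^ 2 = 1) :
    ∫ u, ‖a ⬝ᵥ u‖ * ‖b ⬝ᵥ u‖ ^ 2 ∂stdComplexGaussianVec n =
      √Real.pi / 2 * (1 + ‖b ⬝ᵥ star a‖ ^ 2 / 2) := by
  obtain ⟨s, hs, hcs, h⟩ := integral_dotProduct_pair ha hb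
  rw [h (fun p => ‖p.1‖ * ‖p.2‖ ^ 2) (by fun_prop)]
  have e : ∀ z : ℂ, ‖z‖ * ‖z‖ ^ 2 = ‖z‖ ^ 3 := fun z => by ring
  have i3 : Integrable (fun z : ℂ => ‖z‖ * ‖z‖ ^ 2) stdComplexGaussian := by
    simp_rw [e]
    exact integrable_norm_pow_stdComplexGaussian 3
  have i1 : Integrable (fun z : ℂ => ‖z‖) stdComplexGaussian := by
    simpa using integrable_norm_pow_stdComplexGaussian 1
  rw [integral_mul_norm_sq_add (fun z => ‖z‖) _ _ i1 ?_ i3, integral_norm_stdComplexGaussian]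
  · simp_rw [e]
    rw [integral_norm_pow_three_stdComplexGaussian]
    linear_combination √Real.pi / 2 * hcs
  · refine (integrable_norm_pow_stdComplexGaussian 2).mono' (by fun_prop)
      (.of_forall fun z => ?_)
    simp [pow_succ]

theorem integral_comp_dotProduct (ha : ∑ k, ‖a k‖ ^ 2 = 1) {f : ℂ → ℝ}
    (hf : Continuous f) :
    ∫ u, f (a ⬝ᵥ u) ∂stdComplexGaussianVec n = ∫ z, f z ∂stdComplexGaussian := by
  rw [← map_dotProduct_eq a ha, integral_map (measurable_dotProduct_right a).aemeasurable
    hf.aestronglyMeasurable]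

end linearForms

/-! ### Variance of a quadratic polynomial in independent variables -/

instance holderTriple_four_four_two : ENNReal.HolderTriple 4 4 2 :=
  ⟨by
    have h : (4 : ENNReal)⁻¹ = 2⁻¹ * 2⁻¹ := by
      rw [← ENNReal.mul_inv (by simp) (by simp)]; norm_num
    rw [h, ← mul_add, ENNReal.inv_two_add_inv_two, mul_one]⟩

/-- The variance of `p G + q Y T + m Y²`, where `(G, T)` and `Y` are independent. -/
theorem variance_of_indep_quadratic {Ω : Type*} [MeasurableSpace Ω] {P : Measure Ω}
    [IsProbabilityMeasure P] {G T Y : Ω → ℝ} (hG : MemLp G 2 P) (hT : MemLp T 4 P)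
    (hY : MemLp Y 4 P) (hind : IndepFun (fun ω => (G ω, T ω)) Y P) (p q m : ℝ) :
    MemLp (fun ω => p * G ω + q * (Y ω * T ω) + m * Y ω ^ 2) 2 P ∧
    variance (fun ω => p * G ω + q * (Y ω * T ω) + m * Y ω ^ 2) P =
      p ^ 2 * (P[fun ω => G ω ^ 2] - P[G] ^ 2) +
      q ^ 2 * (P[fun ω => Y ω ^ 2] * P[fun ω => T ω ^ 2] - P[Y] ^ 2 * P[T] ^ 2) +
      m ^ 2 * (P[fun ω => Y ω ^ 4] - P[fun ω => Y ω ^ 2] ^ 2) +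
      2 * p * q * P[Y] * (P[fun ω => G ω * T ω] - P[G] * P[T]) +
      2 * q * m * P[T] * (P[fun ω => Y ω ^ 3] - P[Y] * P[fun ω => Y ω ^ 2]) := by
  have hYT : MemLp (fun ω => Y ω * T ω) 2 P := hT.mul' hY
  have hYY : MemLp (fun ω => Y ω ^ 2) 2 P := by
    simp_rw [sq]
    exact hY.mul' hY
  have hX : MemLp (fun ω => p * G ω + q * (Y ω * T ω) + m * Y ω ^ 2) 2 P :=
    ((hG.const_mul p).add (hYT.const_mul q)).add (hYY.const_mul m)
  refine ⟨hX, ?_⟩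
  have ind : ∀ (f : ℝ × ℝ → ℝ) (g : ℝ → ℝ), Measurable f → Measurable g →
      P[fun ω => f (G ω, T ω) * g (Y ω)] = P[fun ω => f (G ω, T ω)] * P[fun ω => g (Y ω)] :=
    fun f g hf hg => (hind.comp hf hg).integral_fun_mul_eq_mul_integral
      (hf.comp_aemeasurable (hG.aemeasurable.prodMk hT.aemeasurable)).aestronglyMeasurable
      (hg.comp_aemeasurable hY.aemeasurable).aestronglyMeasurable
  have e1 := ind (fun x => x.2) (fun y => y) (by fun_prop) (by fun_prop)
  have e2 := ind (fun x => x.2 ^ 2) (fun y => y ^ 2) (by fun_prop) (by fun_prop)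
  have e3 := ind (fun x => x.1 * x.2) (fun y => y) (by fun_prop) (by fun_prop)
  have e4 := ind (fun x => x.1) (fun y => y ^ 2) (by fun_prop) (by fun_prop)
  have e5 := ind (fun x => x.2) (fun y => y ^ 3) (by fun_prop) (by fun_prop)
  simp only at e1 e2 e3 e4 e5
  have hmean : P[fun ω => p * G ω + q * (Y ω * T ω) + m * Y ω ^ 2] =
      p * P[G] + q * (P[T] * P[Y]) + m * P[fun ω => Y ω ^ 2] := by
    have i1 : Integrable (fun ω => p * G ω) P := (hG.integrable one_le_two).const_mul p
    have i2 : Integrable (fun ω => q * (Y ω * T ω)) P := (hYT.integrable one_le_two).const_mul q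
    have i3 : Integrable (fun ω => m * Y ω ^ 2) P := (hYY.integrable one_le_two).const_mul m
    rw [integral_add (f := fun ω => p * G ω + q * (Y ω * T ω)) (i1.add i2) i3,
      integral_add i1 i2, integral_const_mul, integral_const_mul, integral_const_mul]
    simp_rw [mul_comm (Y _)]
    rw [e1]
  have hsq : P[fun ω => (p * G ω + q * (Y ω * T ω) + m * Y ω ^ 2) ^ 2] =
      p ^ 2 * P[fun ω => G ω ^ 2] + q ^ 2 * (P[fun ω => T ω ^ 2] * P[fun ω => Y ω ^ 2]) +
      m ^ 2 * P[fun ω => Y ω ^ 4] + 2 * p * q * (P[fun ω => G ω * T ω] * P[Y]) +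
      2 * p * m * (P[G] * P[fun ω => Y ω ^ 2]) + 2 * q * m * (P[T] * P[fun ω => Y ω ^ 3]) := by
    have j1 : Integrable (fun ω => p ^ 2 * G ω ^ 2) P := hG.integrable_sq.const_mul _
    have j2 : Integrable (fun ω => q ^ 2 * (T ω ^ 2 * Y ω ^ 2)) P := by
      refine (hYT.integrable_sq.congr (.of_forall fun ω => ?_)).const_mul _
      simp only; ring
    have j3 : Integrable (fun ω => m ^ 2 * Y ω ^ 4) P := by
      refine (hYY.integrable_sq.congr (.of_forall fun ω => ?_)).const_mul _
      simp only; ring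
    have j4 : Integrable (fun ω => 2 * p * q * (G ω * T ω * Y ω)) P := by
      refine ((hG.integrable_mul hYT).congr (.of_forall fun ω => ?_)).const_mul _
      simp only [Pi.mul_apply]; ring
    have j5 : Integrable (fun ω => 2 * p * m * (G ω * Y ω ^ 2)) P :=
      (hG.integrable_mul hYY).const_mul _
    have j6 : Integrable (fun ω => 2 * q * m * (T ω * Y ω ^ 3)) P := by
      refine ((hYT.integrable_mul hYY).congr (.of_forall fun ω => ?_)).const_mul _
      simp only [Pi.mul_apply]; ring
    have hpt : ∀ ω, (p * G ω + q * (Y ω * T ω) + m * Y ω ^ 2) ^ 2 =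
        p ^ 2 * G ω ^ 2 + q ^ 2 * (T ω ^ 2 * Y ω ^ 2) + m ^ 2 * Y ω ^ 4 +
        2 * p * q * (G ω * T ω * Y ω) + 2 * p * m * (G ω * Y ω ^ 2) +
        2 * q * m * (T ω * Y ω ^ 3) := fun ω => by ring
    simp_rw [hpt]
    have k2 := j1.add j2
    have k3 := k2.add j3
    have k4 := k3.add j4
    have k5 := k4.add j5
    simp only [Pi.add_def] at k2 k3 k4 k5
    rw [integral_add k5 j6, integral_add k4 j5, integral_add k3 j4, integral_add k2 j3,
      integral_add j1 j2]
    simp only [integral_const_mul]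
    rw [e2, e3, e4, e5]
  -- The `p m` contributions cancel here, because `G` and `Y²` are uncorrelated.
  rw [variance_eq_sub hX, hmean]
  simp only [Pi.pow_apply]
  rw [hsq]
  ring

/-! ### Moments of correlated channel vectors -/

section correlation

variable {n : ℕ} {R : Matrix (Fin n) (Fin n) ℂ}

theorem correlate_apply (R : Matrix (Fin n) (Fin n) ℂ) (u : Fin n → ℂ) (i : Fin n) :
    correlate R u i = CFC.sqrt R i ⬝ᵥ u := rfl

theorem IsCorrelationMatrix.sqrt_mul_self (hR : IsCorrelationMatrix R) :
    CFC.sqrt R * CFC.sqrt R = R :=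
  CFC.sqrt_mul_sqrt_self R hR.posSemidef.nonneg

theorem conjTranspose_sqrt (R : Matrix (Fin n) (Fin n) ℂ) : (CFC.sqrt R)ᴴ = CFC.sqrt R :=
  (CFC.sqrt_nonneg R).isSelfAdjoint

theorem star_row_sqrt (R : Matrix (Fin n) (Fin n) ℂ) (i : Fin n) :
    star (CFC.sqrt R i) = fun k => CFC.sqrt R k i := by
  ext k
  have := congrFun (congrFun (conjTranspose_sqrt R) k) i
  rwa [Matrix.conjTranspose_apply] at this

/-- The entries of `R^{1/2} u` are linear forms in `u` whose Gram matrix is `R`; the unit diagonal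
makes them normalized, and `ρ_ij` is their correlation. -/
theorem IsCorrelationMatrix.row_dotProduct_star_row (hR : IsCorrelationMatrix R) (i j : Fin n) :
    CFC.sqrt R i ⬝ᵥ star (CFC.sqrt R j) = R i j := by
  rw [star_row_sqrt]
  conv_rhs => rw [← hR.sqrt_mul_self]
  rw [Matrix.mul_apply]
  rfl

theorem dotProduct_star_self_eq_sum (a : Fin n → ℂ) :
    a ⬝ᵥ star a = ((∑ k, ‖a k‖ ^ 2 : ℝ) : ℂ) := by
  rw [dotProduct, Complex.ofReal_sum]
  refine Finset.sum_congr rfl fun k _ => ?_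
  simpa using Complex.mul_conj' (a k)

theorem IsCorrelationMatrix.sum_norm_sq_row (hR : IsCorrelationMatrix R) (i : Fin n) :
    ∑ k, ‖CFC.sqrt R i k‖ ^ 2 = 1 := by
  have h := hR.row_dotProduct_star_row i i
  rw [dotProduct_star_self_eq_sum, hR.diag_eq_one] at h
  exact_mod_cast h

theorem memLp_correlate (R : Matrix (Fin n) (Fin n) ℂ) (i : Fin n) :
    MemLp (fun u => correlate R u i) 4 (stdComplexGaussianVec n) :=
  memLp_dotProduct _

theorem memLp_sumAbs (R : Matrix (Fin n) (Fin n) ℂ) :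
    MemLp (sumAbs R) 4 (stdComplexGaussianVec n) := by
  unfold sumAbs
  exact memLp_finsetSum _ fun i _ => (memLp_correlate R i).norm

theorem hyperTerm_one : hyperTerm 1 = 1 := by simp [hyperTerm]

theorem IsCorrelationMatrix.integral_sumAbs (hR : IsCorrelationMatrix R) :
    ∫ u, sumAbs R u ∂stdComplexGaussianVec n = n * (√Real.pi / 2) := by
  unfold sumAbs
  rw [integral_finsetSum _ fun i _ => ((memLp_correlate R i).integrable (by norm_num)).norm]
  have : ∀ i, ∫ u, ‖correlate R u i‖ ∂stdComplexGaussianVec n = √Real.pi / 2 := fun i => by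
    simp_rw [correlate_apply]
    rw [integral_comp_dotProduct (hR.sum_norm_sq_row i) (f := fun z => ‖z‖) continuous_norm,
      integral_norm_stdComplexGaussian]
  simp [this]

theorem IsCorrelationMatrix.integral_sumAbs_sq (hR : IsCorrelationMatrix R) :
    ∫ u, sumAbs R u ^ 2 ∂stdComplexGaussianVec n = n + constF R := by
  have e : ∀ u, sumAbs R u ^ 2 = ∑ i, ∑ j, ‖correlate R u j‖ * ‖correlate R u i‖ := fun u => by
    unfold sumAbs
    rw [sq, Finset.sum_mul_sum, Finset.sum_comm]
  have hint : ∀ i j, Integrable (fun u => ‖correlate R u j‖ * ‖correlate R u i‖)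
      (stdComplexGaussianVec n) := fun i j =>
    integrable_norm_mul_norm (memLp_correlate R j) (memLp_correlate R i)
  simp_rw [e]
  rw [integral_finsetSum _ fun i _ => integrable_finsetSum _ fun j _ => hint i j]
  simp_rw [integral_finsetSum _ fun j _ => hint _ j, correlate_apply,
    fun i j => integral_norm_mul_norm_dotProduct (hR.sum_norm_sq_row j) (hR.sum_norm_sq_row i),
    hR.row_dotProduct_star_row]
  have : ∀ i j, hyperTerm ‖R i j‖ =
      (if i = j then 1 else 0) + if i ≠ j then hyperTerm ‖R i j‖ else 0 := fun i j => by
    by_cases h : i = j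
    · subst h
      simp [hR.diag_eq_one, hyperTerm_one]
    · simp [h]
  rw [Finset.sum_congr rfl fun i _ => Finset.sum_congr rfl fun j _ => this i j]
  simp_rw [Finset.sum_add_distrib]
  simp [constF]

/-- The squared Euclidean norm of `R^{1/2} u`. -/
noncomputable def sumNormSq (R : Matrix (Fin n) (Fin n) ℂ) (u : Fin n → ℂ) : ℝ :=
  ∑ i, ‖correlate R u i‖ ^ 2

theorem memLp_sumNormSq (R : Matrix (Fin n) (Fin n) ℂ) :
    MemLp (sumNormSq R) 2 (stdComplexGaussianVec n) := by
  unfold sumNormSq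
  simp_rw [sq]
  exact memLp_finsetSum _ fun i _ => (memLp_correlate R i).norm.mul' (memLp_correlate R i).norm

theorem IsCorrelationMatrix.integral_sumNormSq (hR : IsCorrelationMatrix R) :
    ∫ u, sumNormSq R u ∂stdComplexGaussianVec n = n := by
  unfold sumNormSq
  have hint : ∀ i, Integrable (fun u => ‖correlate R u i‖ ^ 2) (stdComplexGaussianVec n) :=
    fun i => by
      simp_rw [sq]
      exact integrable_norm_mul_norm (memLp_correlate R i) (memLp_correlate R i)
  rw [integral_finsetSum _ fun i _ => hint i]
  have : ∀ i, ∫ u, ‖correlate R u i‖ ^ 2 ∂stdComplexGaussianVec n = 1 := fun i => by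
    simp_rw [correlate_apply]
    rw [integral_comp_dotProduct (hR.sum_norm_sq_row i) (f := fun z => ‖z‖ ^ 2)
      (by fun_prop), integral_norm_sq_stdComplexGaussian]
  simp [this]

/-- Each ordered pair contributes `1 + |R_ij|²`, and hermiticity turns `∑ |R_ij|²` into `tr R²`. -/
theorem IsCorrelationMatrix.integral_sumNormSq_sq (hR : IsCorrelationMatrix R) :
    ∫ u, sumNormSq R u ^ 2 ∂stdComplexGaussianVec n = (n : ℝ) ^ 2 + (R ^ 2).trace.re := by
  have e : ∀ u, sumNormSq R u ^ 2 =
      ∑ i, ∑ j, ‖correlate R u j‖ ^ 2 * ‖correlate R u i‖ ^ 2 := fun u => by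
    unfold sumNormSq
    rw [sq, Finset.sum_mul_sum, Finset.sum_comm]
  have hsq : ∀ i, MemLp (fun u => ‖correlate R u i‖ ^ 2) 2 (stdComplexGaussianVec n) :=
    fun i => by
      simp_rw [sq]
      exact (memLp_correlate R i).norm.mul' (memLp_correlate R i).norm
  have hint : ∀ i j, Integrable (fun u => ‖correlate R u j‖ ^ 2 * ‖correlate R u i‖ ^ 2)
      (stdComplexGaussianVec n) := fun i j => (hsq j).integrable_mul (hsq i)
  simp_rw [e]
  rw [integral_finsetSum _ fun i _ => integrable_finsetSum _ fun j _ => hint i j]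
  simp_rw [integral_finsetSum _ fun j _ => hint _ j, correlate_apply,
    fun i j => integral_norm_sq_mul_norm_sq_dotProduct (hR.sum_norm_sq_row j)
      (hR.sum_norm_sq_row i),
    hR.row_dotProduct_star_row, Finset.sum_add_distrib]
  have htr : (R ^ 2).trace.re = ∑ i, ∑ j, ‖R i j‖ ^ 2 := by
    rw [sq, Matrix.trace, Complex.re_sum]
    refine Finset.sum_congr rfl fun i _ => ?_
    rw [Matrix.diag_apply, Matrix.mul_apply, Complex.re_sum]
    refine Finset.sum_congr rfl fun j _ => ?_
    rw [← hR.posSemidef.isHermitian.apply j i]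
    have : R i j * star (R i j) = ((‖R i j‖ ^ 2 : ℝ) : ℂ) := by
      simpa using Complex.mul_conj' (R i j)
    rw [this, Complex.ofReal_re]
  rw [htr]
  simp [sq]

/-- The modulus of the projection of `R^{1/2} u` onto `a`. -/
noncomputable def projNorm (R : Matrix (Fin n) (Fin n) ℂ) (a u : Fin n → ℂ) : ℝ :=
  ‖star a ⬝ᵥ correlate R u‖

theorem constA_sq (R : Matrix (Fin n) (Fin n) ℂ) (a : Fin n → ℂ) :
    constA R a ^ 2 = ∑ i, ‖correlate R a i‖ ^ 2 :=
  Real.sq_sqrt (Finset.sum_nonneg fun _ _ => by positivity)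

/-- The normalized direction `R^{1/2} a / ‖R^{1/2} a‖`, conjugated. -/
noncomputable def unitDirection (R : Matrix (Fin n) (Fin n) ℂ) (a : Fin n → ℂ) : Fin n → ℂ :=
  ((constA R a)⁻¹ : ℂ) • star (correlate R a)

theorem sum_norm_sq_unitDirection {a : Fin n → ℂ} (hA : constA R a ≠ 0) :
    ∑ k, ‖unitDirection R a k‖ ^ 2 = 1 := by
  have : ∀ k, ‖unitDirection R a k‖ ^ 2 = (constA R a ^ 2)⁻¹ * ‖correlate R a k‖ ^ 2 := fun k => by
    simp [unitDirection, mul_pow]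
  simp_rw [this]
  rw [← Finset.mul_sum, ← constA_sq]
  exact inv_mul_cancel₀ (pow_ne_zero 2 hA)

theorem star_dotProduct_correlate {a : Fin n → ℂ} (hA : constA R a ≠ 0) (u : Fin n → ℂ) :
    star a ⬝ᵥ correlate R u = constA R a * (unitDirection R a ⬝ᵥ u) := by
  rw [unitDirection, smul_dotProduct, smul_eq_mul, ← mul_assoc,
    mul_inv_cancel₀ (by exact_mod_cast hA), one_mul, correlate, correlate, Matrix.star_mulVec,
    conjTranspose_sqrt, Matrix.dotProduct_mulVec]

theorem projNorm_eq {a : Fin n → ℂ} (hA : constA R a ≠ 0) (u : Fin n → ℂ) :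
    projNorm R a u = constA R a * ‖unitDirection R a ⬝ᵥ u‖ := by
  rw [projNorm, star_dotProduct_correlate hA, norm_mul, Complex.norm_real, Real.norm_eq_abs,
    abs_of_nonneg (show 0 ≤ constA R a from Real.sqrt_nonneg _)]

theorem memLp_projNorm {a : Fin n → ℂ} (hA : constA R a ≠ 0) :
    MemLp (projNorm R a) 4 (stdComplexGaussianVec n) := by
  rw [funext (projNorm_eq hA)]
  exact (memLp_dotProduct _).norm.const_mul _

/-- Where the projection vanishes, `psi` is `0/0 = 0` rather than a phase; this makes that event
negligible. -/
theorem ae_projNorm_ne_zero {a : Fin n → ℂ} (hA : constA R a ≠ 0) :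
    ∀ᵐ u ∂stdComplexGaussianVec n, projNorm R a u ≠ 0 := by
  have h := ae_ne_zero_stdComplexGaussian
  rw [← map_dotProduct_eq _ (sum_norm_sq_unitDirection hA)] at h
  filter_upwards [ae_of_ae_map (measurable_dotProduct_right _).aemeasurable h] with u hu
  rw [projNorm_eq hA]
  exact mul_ne_zero hA (norm_ne_zero_iff.2 hu)

theorem integral_projNorm {a : Fin n → ℂ} (hA : constA R a ≠ 0) :
    ∫ u, projNorm R a u ∂stdComplexGaussianVec n = constA R a * (√Real.pi / 2) := by
  simp_rw [projNorm_eq hA]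
  rw [integral_const_mul, integral_comp_dotProduct (sum_norm_sq_unitDirection hA)
    (f := fun z => ‖z‖) continuous_norm, integral_norm_stdComplexGaussian]

theorem integral_projNorm_sq {a : Fin n → ℂ} (hA : constA R a ≠ 0) :
    ∫ u, projNorm R a u ^ 2 ∂stdComplexGaussianVec n = constA R a ^ 2 := by
  simp_rw [projNorm_eq hA, mul_pow]
  rw [integral_const_mul, integral_comp_dotProduct (sum_norm_sq_unitDirection hA)
    (f := fun z => ‖z‖ ^ 2) (by fun_prop), integral_norm_sq_stdComplexGaussian, mul_one]

/-- The `i`-th entry of `R^{1/2} u` has correlation `(R a)_i / A` with the normalized projection.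
Summing `A (1 + |(R a)_i|² / (2 A²))` over `i` produces `B`. -/
theorem IsCorrelationMatrix.integral_sumNormSq_mul_projNorm (hR : IsCorrelationMatrix R)
    {a : Fin n → ℂ} (hA : constA R a ≠ 0) :
    ∫ u, sumNormSq R u * projNorm R a u ∂stdComplexGaussianVec n =
      √Real.pi / 2 * constB R a := by
  have e : ∀ u, sumNormSq R u * projNorm R a u =
      ∑ i, constA R a * (‖unitDirection R a ⬝ᵥ u‖ * ‖CFC.sqrt R i ⬝ᵥ u‖ ^ 2) := fun u => by
    rw [projNorm_eq hA, sumNormSq, Finset.sum_mul]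
    refine Finset.sum_congr rfl fun i _ => ?_
    rw [correlate_apply]
    ring
  have hint : ∀ i, Integrable (fun u => constA R a *
      (‖unitDirection R a ⬝ᵥ u‖ * ‖CFC.sqrt R i ⬝ᵥ u‖ ^ 2)) (stdComplexGaussianVec n) := fun i => by
    have h1 : MemLp (fun u => ‖CFC.sqrt R i ⬝ᵥ u‖ ^ 2) 2 (stdComplexGaussianVec n) := by
      simp_rw [sq]
      exact (memLp_dotProduct _).norm.mul' (memLp_dotProduct _).norm
    have h2 : MemLp (fun u => ‖unitDirection R a ⬝ᵥ u‖) 2 (stdComplexGaussianVec n) :=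
      (memLp_dotProduct _).norm.mono_exponent (by norm_num)
    exact (h2.integrable_mul h1).const_mul _
  simp_rw [e]
  rw [integral_finsetSum _ fun i _ => hint i]
  simp_rw [integral_const_mul, fun i => integral_norm_mul_norm_sq_dotProduct
    (sum_norm_sq_unitDirection hA) (hR.sum_norm_sq_row i)]
  have hc : ∀ i, CFC.sqrt R i ⬝ᵥ star (unitDirection R a) = (constA R a : ℂ)⁻¹ * (R *ᵥ a) i :=
    fun i => by
      rw [unitDirection, star_smul, star_star, dotProduct_smul, smul_eq_mul]
      congr 1
      · simp
      · change (CFC.sqrt R *ᵥ correlate R a) i = _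
        rw [correlate, Matrix.mulVec_mulVec, hR.sqrt_mul_self]
  have hquad : (star a ⬝ᵥ (R ^ 2 *ᵥ a)).re = ∑ i, ‖(R *ᵥ a) i‖ ^ 2 := by
    rw [sq, ← Matrix.mulVec_mulVec, Matrix.dotProduct_mulVec]
    have : star a ᵥ* R = star (R *ᵥ a) := by
      rw [Matrix.star_mulVec, hR.posSemidef.isHermitian.eq]
    rw [this, dotProduct_comm, dotProduct_star_self_eq_sum, Complex.ofReal_re]
  rw [constB, hquad]
  simp_rw [hc, norm_mul, mul_pow, mul_add, Finset.sum_add_distrib, mul_div_assoc, norm_inv,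
    Complex.norm_real, Real.norm_eq_abs, inv_pow, sq_abs, ← mul_div_assoc, ← Finset.sum_div,
    ← Finset.mul_sum]
  simp only [Finset.sum_const, Finset.card_univ, Fintype.card_fin, nsmul_eq_mul]
  field_simp

end correlation

/-! ### The SNR under the optimal phases -/

section channel

variable {M N : ℕ}

theorem exp_neg_arg_mul (z : ℂ) : Complex.exp (-(Complex.I * (z.arg : ℂ))) * z = ‖z‖ := by
  calc Complex.exp (-(Complex.I * (z.arg : ℂ))) * z
      = Complex.exp (-(Complex.I * (z.arg : ℂ))) * (‖z‖ * Complex.exp (z.arg * Complex.I)) := by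
        rw [Complex.norm_mul_exp_arg_mul_I]
    _ = ‖z‖ * Complex.exp (-(Complex.I * (z.arg : ℂ)) + z.arg * Complex.I) := by
        rw [Complex.exp_add]; ring
    _ = ‖z‖ := by
        rw [mul_comm Complex.I, neg_add_cancel, Complex.exp_zero, mul_one]

theorem conj_mul_exp_arg (z : ℂ) : star z * Complex.exp (Complex.I * (z.arg : ℂ)) = ‖z‖ := by
  have h := congrArg (starRingEnd ℂ) (exp_neg_arg_mul z)
  rw [map_mul, ← Complex.exp_conj, map_neg, map_mul, Complex.conj_I, Complex.conj_ofReal,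
    Complex.conj_ofReal, neg_mul, neg_neg, mul_comm] at h
  exact h

theorem losChannel_mul_optimalPhase_mulVec (β : ℝ) (ab hd : Fin M → ℂ) (ar hru : Fin N → ℂ)
    (har : ∀ n, ‖ar n‖ = 1) :
    (losChannel β ab ar * optimalPhase ab ar hd hru) *ᵥ hru =
      (((√β * ∑ n, ‖hru n‖ : ℝ) : ℂ) * psi ab hd) • ab := by
  ext i
  rw [← Matrix.mulVec_mulVec, losChannel, Matrix.smul_mulVec, Pi.smul_apply, Pi.smul_apply,
    Matrix.mulVec, dotProduct, smul_eq_mul, smul_eq_mul]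
  have : ∀ n, Matrix.vecMulVec ab (star ar) i n * (optimalPhase ab ar hd hru *ᵥ hru) n =
      psi ab hd * ab i * ‖hru n‖ := fun n => by
    rw [optimalPhase, Matrix.smul_mulVec, Pi.smul_apply, ← Matrix.mulVec_mulVec,
      Matrix.mulVec_diagonal, Matrix.mulVec_diagonal, Matrix.vecMulVec_apply, smul_eq_mul,
      exp_neg_arg_mul]
    have h := conj_mul_exp_arg (ar n)
    rw [har n] at h
    rw [Pi.star_apply]
    push_cast at h
    linear_combination psi ab hd * ab i * ‖hru n‖ * h
  simp_rw [this]
  rw [← Finset.mul_sum]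
  push_cast
  ring

theorem star_dotProduct_self_re (h : Fin M → ℂ) : (star h ⬝ᵥ h).re = ∑ i, ‖h i‖ ^ 2 := by
  rw [dotProduct_comm, dotProduct_star_self_eq_sum, Complex.ofReal_re]

/-- The phase `ψ` satisfies `ψ̄ a_bᴴ h_d = |a_bᴴ h_d|`, so the cross term is real and equals `r`
times the modulus of the projection. -/
theorem sum_norm_sq_add_smul (hd ab : Fin M → ℂ) (r : ℝ) (hs : star ab ⬝ᵥ hd ≠ 0) :
    ∑ i, ‖(hd + ((r : ℂ) * psi ab hd) • ab) i‖ ^ 2 =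
      ∑ i, ‖hd i‖ ^ 2 + 2 * r * ‖star ab ⬝ᵥ hd‖ + r ^ 2 * ∑ i, ‖ab i‖ ^ 2 := by
  have hn : ‖star ab ⬝ᵥ hd‖ ≠ 0 := norm_ne_zero_iff.2 hs
  have hpsi : ‖psi ab hd‖ = 1 := by
    rw [psi, norm_div, Complex.norm_real, norm_norm, div_self hn]
  have hcross : ∑ i, (hd i * star ((r : ℂ) * psi ab hd * ab i)).re =
      r * ‖star ab ⬝ᵥ hd‖ := by
    have h1 : star (psi ab hd) * (star ab ⬝ᵥ hd) = ‖star ab ⬝ᵥ hd‖ := by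
      rw [psi, star_div₀]
      have h2 : star (star ab ⬝ᵥ hd) * (star ab ⬝ᵥ hd) = (‖star ab ⬝ᵥ hd‖ : ℂ) ^ 2 := by
        simpa using Complex.conj_mul' (star ab ⬝ᵥ hd)
      rw [div_mul_eq_mul_div, h2]
      have h3 : star ((‖star ab ⬝ᵥ hd‖ : ℝ) : ℂ) = ‖star ab ⬝ᵥ hd‖ := Complex.conj_ofReal _
      rw [h3]
      have : (‖star ab ⬝ᵥ hd‖ : ℂ) ≠ 0 := by exact_mod_cast hn
      field_simp
    rw [← Complex.re_sum]
    have : ∑ i, hd i * star ((r : ℂ) * psi ab hd * ab i) =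
        r * (star (psi ab hd) * (star ab ⬝ᵥ hd)) := by
      rw [dotProduct, Finset.mul_sum, Finset.mul_sum]
      refine Finset.sum_congr rfl fun i _ => ?_
      simp
      ring
    rw [this, h1, ← Complex.ofReal_mul, Complex.ofReal_re]
  simp only [Pi.add_apply, Pi.smul_apply, smul_eq_mul]
  simp_rw [norm_sq_add_complex, Finset.sum_add_distrib, ← Finset.mul_sum, hcross, norm_mul, hpsi,
    mul_pow, ← Finset.mul_sum, Complex.norm_real, Real.norm_eq_abs, sq_abs]
  ring

theorem norm_rayleigh_apply (β : ℝ) (R : Matrix (Fin M) (Fin M) ℂ) (u : Fin M → ℂ) (i : Fin M) :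
    ‖rayleigh β R u i‖ = √β * ‖correlate R u i‖ := by
  rw [rayleigh, Pi.smul_apply, norm_smul, Complex.norm_real, Real.norm_eq_abs,
    abs_of_nonneg (Real.sqrt_nonneg _)]

/-- The optimal SNR as a quadratic polynomial in the three basic random variables. -/
theorem optimalSNR_eq {βd βbr βru τ : ℝ} (hβd : 0 < βd) (hβbr : 0 < βbr) (hβru : 0 < βru)
    (Rd : Matrix (Fin M) (Fin M) ℂ) (Rru : Matrix (Fin N) (Fin N) ℂ)
    {ab : Fin M → ℂ} (hab : ∑ i, ‖ab i‖ ^ 2 = (M : ℝ))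
    {ar : Fin N → ℂ} (har : ∀ n, ‖ar n‖ = 1) (ud : Fin M → ℂ) (uru : Fin N → ℂ)
    (hT : projNorm Rd ab ud ≠ 0) :
    optimalSNR βd βbr βru τ Rd Rru ab ar ud uru =
      βd * τ * sumNormSq Rd ud +
        2 * √βd * √(βbr * βru) * τ * (sumAbs Rru uru * projNorm Rd ab ud) +
        M * (βbr * βru) * τ * sumAbs Rru uru ^ 2 := by
  have hd : star ab ⬝ᵥ rayleigh βd Rd ud = (√βd : ℝ) * (star ab ⬝ᵥ correlate Rd ud) := by
    rw [rayleigh, dotProduct_smul, smul_eq_mul]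
  have hdn : ‖star ab ⬝ᵥ rayleigh βd Rd ud‖ = √βd * projNorm Rd ab ud := by
    rw [hd, norm_mul, Complex.norm_real, Real.norm_eq_abs, abs_of_nonneg (Real.sqrt_nonneg _)]
    rfl
  have hne : star ab ⬝ᵥ rayleigh βd Rd ud ≠ 0 := by
    rw [← norm_ne_zero_iff, hdn]
    exact mul_ne_zero (Real.sqrt_pos.2 hβd).ne' hT
  rw [optimalSNR, snr, globalChannel, losChannel_mul_optimalPhase_mulVec _ _ _ _ _ har,
    star_dotProduct_self_re, sum_norm_sq_add_smul _ _ _ hne, hdn, hab]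
  simp_rw [norm_rayleigh_apply, ← Finset.mul_sum, mul_pow, ← Finset.mul_sum]
  rw [Real.sq_sqrt hβd.le, Real.sq_sqrt hβbr.le, Real.sq_sqrt hβru.le, Real.sqrt_mul hβbr.le]
  change (βd * sumNormSq Rd ud + 2 * (√βbr * (√βru * sumAbs Rru uru)) * _ +
    βbr * (βru * sumAbs Rru uru ^ 2) * _) * τ = _
  ring

end channel

end RIS

/-! ### Assembly of the variance formula -/

theorem theorem2 {Ω : Type*} [MeasurableSpace Ω] (P : Measure Ω) [IsProbabilityMeasure P]
    (M N : ℕ)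
    (βd βbr βru Es σ : ℝ) (hβd : 0 < βd) (hβbr : 0 < βbr) (hβru : 0 < βru)
    (hEs : 0 < Es) (hσ : 0 < σ)
    (Rd : Matrix (Fin M) (Fin M) ℂ) (hRd : RIS.IsCorrelationMatrix Rd)
    (Rru : Matrix (Fin N) (Fin N) ℂ) (hRru : RIS.IsCorrelationMatrix Rru)
    (ab : Fin M → ℂ) (hab : ∑ i, ‖ab i‖ ^ 2 = (M : ℝ))
    (ar : Fin N → ℂ) (har : ∀ n, ‖ar n‖ = 1)
    (hA : RIS.constA Rd ab ≠ 0)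
    (ud : Ω → Fin M → ℂ) (hud : HasLaw ud (RIS.stdComplexGaussianVec M) P)
    (uru : Ω → Fin N → ℂ) (huru : HasLaw uru (RIS.stdComplexGaussianVec N) P)
    (hindep : IndepFun ud uru P)
    (SNR Y : Ω → ℝ) (τ A B F C₁ C₂ : ℝ)
    (hτ : τ = Es / σ ^ 2)
    (hSNR : SNR = fun ω => RIS.optimalSNR βd βbr βru τ Rd Rru ab ar (ud ω) (uru ω))
    (hY : Y = fun ω => RIS.sumAbs Rru (uru ω))
    (hAdef : A = RIS.constA Rd ab) (hB : B = RIS.constB Rd ab) (hF : F = RIS.constF Rru)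
    (hC₁ : C₁ = ∫ ω, Y ω ^ 3 ∂P) (hC₂ : C₂ = ∫ ω, Y ω ^ 4 ∂P) :
    MemLp SNR 2 P ∧ Integrable (fun ω => Y ω ^ 3) P ∧ Integrable (fun ω => Y ω ^ 4) P ∧
    variance SNR P =
      (βd ^ 2 * (Rd ^ 2).trace.re
        + βd ^ (3 / 2 : ℝ) * Real.sqrt (βbr * βru) * N * Real.pi * (B - M * A)
        + βd * βbr * βru * A ^ 2 * (4 * (N + F) - (N : ℝ) ^ 2 * Real.pi ^ 2 / 4)
        + M * A * Real.sqrt βd * (βbr * βru) ^ (3 / 2 : ℝ)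
            * (2 * Real.sqrt Real.pi * C₁ - N * (N + F) * Real.pi)
        + (M * βbr * βru) ^ 2 * (C₂ - (N + F) ^ 2)) * τ ^ 2 := by
  have hlawM := hud.map_eq
  have hlawN := huru.map_eq
  have mG : MemLp (fun ω => RIS.sumNormSq Rd (ud ω)) 2 P := by
    refine MemLp.comp_of_map (g := RIS.sumNormSq Rd) (f := ud) ?_ hud.aemeasurable
    rw [hlawM]
    exact RIS.memLp_sumNormSq Rd
  have mT : MemLp (fun ω => RIS.projNorm Rd ab (ud ω)) 4 P := by
    refine MemLp.comp_of_map (g := RIS.projNorm Rd ab) (f := ud) ?_ hud.aemeasurable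
    rw [hlawM]
    exact RIS.memLp_projNorm hA
  have mY : MemLp Y 4 P := by
    rw [hY]
    refine MemLp.comp_of_map (g := RIS.sumAbs Rru) (f := uru) ?_ huru.aemeasurable
    rw [hlawN]
    exact RIS.memLp_sumAbs Rru
  have cY : Continuous (RIS.sumAbs Rru) := by
    unfold RIS.sumAbs
    simp_rw [RIS.correlate_apply]
    unfold dotProduct
    fun_prop
  have cG : Continuous (RIS.sumNormSq Rd) := by
    unfold RIS.sumNormSq
    simp_rw [RIS.correlate_apply]
    unfold dotProduct
    fun_prop
  have cT : Continuous (RIS.projNorm Rd ab) := by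
    rw [funext (RIS.projNorm_eq hA)]
    unfold dotProduct
    fun_prop
  have hind : IndepFun (fun ω => (RIS.sumNormSq Rd (ud ω), RIS.projNorm Rd ab (ud ω))) Y P := by
    rw [hY]
    exact hindep.comp (φ := fun u => (RIS.sumNormSq Rd u, RIS.projNorm Rd ab u))
      (ψ := RIS.sumAbs Rru) (cG.measurable.prodMk cT.measurable) cY.measurable
  have expM : ∀ f : (Fin M → ℂ) → ℝ, Continuous f →
      ∫ ω, f (ud ω) ∂P = ∫ u, f u ∂(RIS.stdComplexGaussianVec M) := fun f hf =>
    hud.integral_comp hf.aestronglyMeasurable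
  have expN : ∀ f : (Fin N → ℂ) → ℝ, Continuous f →
      ∫ ω, f (uru ω) ∂P = ∫ u, f u ∂(RIS.stdComplexGaussianVec N) := fun f hf =>
    huru.integral_comp hf.aestronglyMeasurable
  have iY3 : Integrable (fun ω => Y ω ^ 3) P := by
    have h := (mY.mono_exponent (by norm_num : (3 : ENNReal) ≤ 4)).integrable_norm_pow (p := 3)
      (by norm_num)
    refine h.congr (.of_forall fun ω => ?_)
    have : 0 ≤ Y ω := by
      rw [hY]
      exact Finset.sum_nonneg fun _ _ => norm_nonneg _
    simp only [Real.norm_eq_abs, abs_of_nonneg this]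
  have iY4 : Integrable (fun ω => Y ω ^ 4) P := by
    have h := mY.integrable_norm_pow (p := 4) (by norm_num)
    refine h.congr (.of_forall fun ω => ?_)
    simp [Real.norm_eq_abs, Even.pow_abs (by decide : Even 4)]
  have hae : SNR =ᵐ[P] fun ω => βd * τ * RIS.sumNormSq Rd (ud ω) +
      2 * √βd * √(βbr * βru) * τ * (Y ω * RIS.projNorm Rd ab (ud ω)) +
      M * (βbr * βru) * τ * Y ω ^ 2 := by
    have h := RIS.ae_projNorm_ne_zero (R := Rd) hA
    rw [← hlawM] at h
    filter_upwards [ae_of_ae_map hud.aemeasurable h] with ω hω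
    rw [hSNR, hY]
    exact RIS.optimalSNR_eq hβd hβbr hβru Rd Rru hab har (ud ω) (uru ω) hω
  obtain ⟨hmem, hvar⟩ := RIS.variance_of_indep_quadratic mG mT mY hind (βd * τ)
    (2 * √βd * √(βbr * βru) * τ) (M * (βbr * βru) * τ)
  refine ⟨(memLp_congr_ae hae).2 hmem, iY3, iY4, ?_⟩
  have eY : ∫ ω, Y ω ∂P = N * (√Real.pi / 2) := by
    rw [hY, expN _ cY, hRru.integral_sumAbs]
  have eY2 : ∫ ω, Y ω ^ 2 ∂P = N + F := by
    rw [hY, hF, ← hRru.integral_sumAbs_sq]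
    exact expN (fun u => RIS.sumAbs Rru u ^ 2) (cY.pow 2)
  have eG := (expM _ cG).trans hRd.integral_sumNormSq
  have eG2 := (expM (fun u => RIS.sumNormSq Rd u ^ 2) (cG.pow 2)).trans hRd.integral_sumNormSq_sq
  have eT := (expM _ cT).trans (RIS.integral_projNorm hA)
  have eT2 := (expM (fun u => RIS.projNorm Rd ab u ^ 2) (cT.pow 2)).trans
    (RIS.integral_projNorm_sq hA)
  have eGT := (expM (fun u => RIS.sumNormSq Rd u * RIS.projNorm Rd ab u) (cG.mul cT)).trans
    (hRd.integral_sumNormSq_mul_projNorm hA)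
  rw [variance_congr hae, hvar, eY, eY2, eG, eG2, eT, eT2, eGT, ← hAdef, ← hB, ← hC₁, ← hC₂]
  have hpow : ∀ x : ℝ, 0 < x → x ^ (3 / 2 : ℝ) = √x ^ 3 := fun x hx => by
    rw [Real.sqrt_eq_rpow, ← Real.rpow_natCast, ← Real.rpow_mul hx.le]
    norm_num
  rw [hpow _ hβd, hpow _ (mul_pos hβbr hβru)]
  -- With the three square roots as variables, all half-integer powers become monomials and the
  -- claim is a polynomial identity.
  obtain ⟨x, hx⟩ : ∃ x, x = √βd := ⟨_, rfl⟩
  obtain ⟨y, hy⟩ : ∃ y, y = √(βbr * βru) := ⟨_, rfl⟩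
  obtain ⟨w, hw⟩ : ∃ w, w = √Real.pi := ⟨_, rfl⟩
  have hx2 : βd = x ^ 2 := by rw [hx, Real.sq_sqrt hβd.le]
  have hy2 : βbr * βru = y ^ 2 := by rw [hy, Real.sq_sqrt (mul_pos hβbr hβru).le]
  have hw2 : Real.pi = w ^ 2 := by rw [hw, Real.sq_sqrt Real.pi_pos.le]
  rw [mul_assoc βd βbr βru, mul_assoc (M : ℝ) βbr βru, ← hx, ← hy, ← hw, hy2, hw2, hx2]
  ring
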